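/- Let $M$ be a smooth $d$-dimensional manifold (Hausdorff, second countable, without boundary), equipped with its Borel $\sigma$-algebra, and let $\mathbb{K}=\mathbb{R}$ or $\mathbb{C}$. A local chart is a pair $(U,\phi)$ with $U\subset M$ open and $\phi:U\to\phi(U)\subset\mathbb{R}^d$ a diffeomorphism onto an open set; an atlas of $M$ is a set of local charts whose domains cover $M$. For $\Omega\subset\mathbb{R}^d$ open, $\mathcal{D}(\Omega)$ is the space of smooth compactly supported functions $\Omega\to\mathbb{K}$ with its usual locally convex topology and $\mathcal{D}'(\Omega)$ is the space of continuous linear functionals on it. A distribution $t\in\mathcal{D}'(M)$ is a family of distributions $\phi_*t\in\mathcal{D}'(\phi(U))$, one for each local chart $(U,\phi)$ of $M$, such that $\phi'_*t=(\phi\circ\phi'^{-1})^*(\phi_*t)$ on $\phi'(U\cap U')$ for all local charts $(U,\phi),(U',\phi')$; here, for a diffeomorphism $\chi:V'\to V$ of open sets, $(\chi^*u)(h)=u\big(|\det D(\chi^{-1})|\,h\circ\chi^{-1}\big)$. For $f:\mathbb{R}^d\to\mathbb{K}$, $x\in\mathbb{R}^d$ and $\lambda>0$ put $f_x^\lambda(y)=\lambda^{-d}f(\lambda^{-1}(y-x))$;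 test functions on $\Omega$ are extended by zero to $\mathbb{R}^d$. A germ of distributions is a family $F=(F_p)_{p\in M}$ in $\mathcal{D}'(M)$ such that $p\mapsto(\phi_*F_p)(h)$ is Borel measurable on $M$ for every local chart $(U,\phi)$ and every $h\in\mathcal{D}(\phi(U))$. It is $\gamma$-coherent on $(M,\mathcal{A})$ if for every $(U,\phi)\in\mathcal{A}$ with $U\neq\emptyset$ there is $f\in\mathcal{D}(\phi(U))$ with $\int f\,dx\neq0$ such that for every compact $K\subset U$ there are $\alpha\le\min\{0,\gamma\}$, $C\in\mathbb{R}$ and $\eta\in(0,1]$ with $$|(\phi_*F_p-\phi_*F_q)(f^\lambda_{\phi(q)})|\le C\,\lambda^{\alpha}\,(|\phi(p)-\phi(q)|+\lambda)^{\gamma-\alpha}$$ for all $p,q\in K$ and all $\lambda\in(0,\eta]$ with $f^\lambda_{\phi(q)}\in\mathcal{D}(\phi(U))$. A distribution $R\in\mathcal{D}'(M)$ is a ($\gamma$-)reconstruction of $F$ with respect to $\mathcal{A}$ if for every $(U,\phi)\in\mathcal{A}$, every compact $K\subset U$ and every $h\in\mathcal{D}(\phi(U))$ there are $C\in\mathbb{R}$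 and $\eta\in(0,1]$ with $$|(\phi_*R-\phi_*F_p)(h^\lambda_{\phi(p)})|\le C\,\lambda^\gamma$$ for all $p\in K$ and all $\lambda\in(0,\eta]$ with $h^\lambda_{\phi(p)}\in\mathcal{D}(\phi(U))$. **Theorem.** Let $\mathcal{A}$ and $\mathcal{A}'$ be two atlases of $M$, let $\gamma>0$, and let $F=(F_p)_{p\in M}$ be a germ of distributions that is $\gamma$-coherent on $(M,\mathcal{A})$. Then $F$ has exactly one reconstruction $\mathcal{R}_{\mathcal{A}}F$ with respect to $\mathcal{A}$ and exactly one reconstruction $\mathcal{R}_{\mathcal{A}'}F$ with respect to $\mathcal{A}'$, and $\mathcal{R}_{\mathcal{A}}F=\mathcal{R}_{\mathcal{A}'}F$ in $\mathcal{D}'(M)$, i.e. the reconstruction is independent of the atlas. -/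

import Mathlib

open scoped Manifold ContDiff Distributions

noncomputable section

namespace GermReconstruction

/-- The Euclidean space `ℝ^d`. -/
abbrev E (d : ℕ) : Type := EuclideanSpace ℝ (Fin d)

/-- A distribution on the open set `Ω ⊆ ℝ^d`: a continuous `𝕜`-linear functional on the space
`𝓓(Ω, 𝕜)` of smooth compactly supported functions on `Ω`, with its usual locally convex topology
(`𝕜` is `ℝ` or `ℂ`). -/
abbrev Distr (𝕜 : Type*) [RCLike 𝕜] {d : ℕ} (Ω : TopologicalSpace.Opens (E d)) : Type _ :=
  𝓓(Ω, 𝕜) →L[𝕜] 𝕜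

/-- The rescaled and recentred function `f_x^s(y) = s^{-d} f (s^{-1} (y - x))`. -/
def rescale {𝕜 : Type*} [RCLike 𝕜] {d : ℕ} (f : E d → 𝕜) (x : E d) (s : ℝ) : E d → 𝕜 :=
  fun y => (s ^ d)⁻¹ • f (s⁻¹ • (y - x))

/-- For a diffeomorphism `χ` between open subsets of `ℝ^d` and `h` supported in the source of `χ`,
this is the function `|det D(χ⁻¹)| · (h ∘ χ⁻¹)` on the target of `χ`, extended by zero. It is the
transpose of the pull-back of distributions:
`∫ (u ∘ χ) h = ∫ u · |det D(χ⁻¹)| (h ∘ χ⁻¹)` for functions `u`. -/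
def transport {𝕜 : Type*} [RCLike 𝕜] {d : ℕ} (χ : OpenPartialHomeomorph (E d) (E d))
    (h : E d → 𝕜) : E d → 𝕜 :=
  χ.target.indicator fun y => |(fderiv ℝ χ.symm y).det| • h (χ.symm y)

/-- `t' = χ^* t` on the source of `χ`, where `χ` is a diffeomorphism from an open subset of `Ω'`
onto an open subset of `Ω`: for every test function `h` supported in the source of `χ`,
`t'(h) = t(|det D(χ⁻¹)| (h ∘ χ⁻¹))`. (For smooth `χ` the function on the right is the unique
test function `g` below.) -/
def EqPullback {𝕜 : Type*} [RCLike 𝕜] {d : ℕ} {Ω Ω' : TopologicalSpace.Opens (E d)}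
    (χ : OpenPartialHomeomorph (E d) (E d)) (t' : Distr 𝕜 Ω') (t : Distr 𝕜 Ω) : Prop :=
  ∀ (h : 𝓓(Ω', 𝕜)) (g : 𝓓(Ω, 𝕜)), tsupport h ⊆ χ.source → (∀ y, g y = transport χ h y) →
    t' h = t g

section Manifold

variable (𝕜 : Type*) [RCLike 𝕜] (d : ℕ) (M : Type*) [TopologicalSpace M]
  [ChartedSpace (E d) M]

/-- The smooth local charts `(U, φ)` of `M`; `U` is the source, `φ(U)` the target. -/
abbrev Chart : Type _ :=
  {e : OpenPartialHomeomorph M (E d) // e ∈ IsManifold.maximalAtlas (𝓡 d) ∞ M}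

variable {d M} in
/-- The open set `φ(U) ⊆ ℝ^d` of a chart `(U, φ)`. -/
def Chart.image (e : Chart d M) : TopologicalSpace.Opens (E d) :=
  ⟨e.1.target, e.1.open_target⟩

variable {d M} in
/-- A smooth atlas of `M`: a set of smooth local charts whose domains cover `M`. -/
def IsAtlas (A : Set (Chart d M)) : Prop :=
  ∀ p : M, ∃ e ∈ A, p ∈ e.1.source

/-- A distribution on the manifold `M`: a family of distributions `t_{φ(U)}` on `φ(U)`, one for
each local chart `(U, φ)`, with the overlapping condition
`t_{φ'(U')} = (φ ∘ φ'⁻¹)^* t_{φ(U)}` on `φ'(U ∩ U')`. The component at `(U, φ)` is the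
push-forward `φ_* t`. -/
@[ext]
structure MDistr where
  /-- The push-forward `φ_* t`, for each chart `(U, φ)`. -/
  push : (e : Chart d M) → Distr 𝕜 e.image
  overlap : ∀ e e' : Chart d M, EqPullback (e'.1.symm.trans e.1) (push e') (push e)

variable {𝕜 d M}

/-- A germ of distributions: a family `F_p`, `p ∈ M`, of distributions on `M` such that
`p ↦ F_p(h)` is Borel measurable for every test function `h`; as every test function on `M` is
a finite sum of test functions supported in chart domains, this is required of the latter. -/
def IsGerm [MeasurableSpace M] (F : M → MDistr 𝕜 d M) : Prop :=
  ∀ (e : Chart d M) (h : 𝓓(e.image, 𝕜)), Measurable fun p => (F p).push e h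

/-- The family `F` is `γ`-coherent on `(M, A)`: for each (nonempty) chart `(U, φ)` in `A` there is
a test function `f` on `φ(U)` with nonzero integral such that for each compact `K ⊆ U` there is
`α ≤ min {0, γ}` with
`|(φ_* F_p - φ_* F_q)(f_{φ(q)}^s)| ≤ C s^α (|φ(p) - φ(q)| + s)^{γ - α}`
uniformly in `p, q ∈ K` and in small scales `s ∈ (0, η]`. The variable `g` is the rescaled function
`f_{φ(q)}^s` as a test function on `φ(U)`, which it is for all `q ∈ K` once `s` is small. -/
def IsCoherent (γ : ℝ) (A : Set (Chart d M)) (F : M → MDistr 𝕜 d M) : Prop :=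
  ∀ e ∈ A, e.1.source.Nonempty → ∃ f : 𝓓(e.image, 𝕜), (∫ x, f x) ≠ 0 ∧
    ∀ K : Set M, IsCompact K → K ⊆ e.1.source →
      ∃ α : ℝ, α ≤ min 0 γ ∧ ∃ C : ℝ, ∃ η ∈ Set.Ioc (0 : ℝ) 1,
        ∀ p ∈ K, ∀ q ∈ K, ∀ s ∈ Set.Ioc 0 η, ∀ g : 𝓓(e.image, 𝕜),
          (∀ y, g y = rescale f (e.1 q) s y) →
            ‖(F p).push e g - (F q).push e g‖
              ≤ C * (s ^ α * (‖e.1 p - e.1 q‖ + s) ^ (γ - α))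

/-- `R` is a reconstruction of the family `F` with respect to the atlas `A`: for each chart
`(U, φ)` in `A`, each compact `K ⊆ U` and each test function `h` on `φ(U)`,
`|(φ_* R - φ_* F_p)(h_{φ(p)}^s)| ≤ C s^γ` uniformly in `p ∈ K` and in small scales `s ∈ (0, η]`.
The variable `g` is `h_{φ(p)}^s` as a test function on `φ(U)`. -/
def IsReconstruction (γ : ℝ) (A : Set (Chart d M)) (F : M → MDistr 𝕜 d M)
    (R : MDistr 𝕜 d M) : Prop :=
  ∀ e ∈ A, ∀ K : Set M, IsCompact K → K ⊆ e.1.source → ∀ h : 𝓓(e.image, 𝕜),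
    ∃ C : ℝ, ∃ η ∈ Set.Ioc (0 : ℝ) 1,
      ∀ p ∈ K, ∀ s ∈ Set.Ioc 0 η, ∀ g : 𝓓(e.image, 𝕜),
        (∀ y, g y = rescale h (e.1 p) s y) →
          ‖R.push e g - (F p).push e g‖ ≤ C * s ^ γ

end Manifold

end GermReconstruction

end

/-!
Everything is reduced to functionals on `ℝ^d` that are linear on the test functions supported in an
open set `W` and obey finite order bounds there.

*From one test function to all of them.* Coherence is only assumed for the rescalings of a single
`f` with `∫ f ≠ 0`. Averaging the bound for these rescalings against smooth densities shows that a
functional which is small on all `f_z^s` is small on every function `f_s ∗ g`. After normalizing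
`∫ f = 1`, the residual `g - f_s ∗ g` is smaller than `g` by the factor `s` at the cost of one
derivative. Iterating this along a geometric sequence of scales, and using the finite order of the
distributions to dispose of the last residual, yields the bound for every test function normalized
in `C^r` at its scale (`exists_bound_of_rescale_bound`). The resulting notion `StronglyCoherent`
mentions no particular test function; it is local and invariant under diffeomorphisms, so that it
passes from the charts of one atlas to every chart of the manifold.

*Existence.* In a chart, let `ψ_k` be a smooth partition of unity with `ψ_k` concentrated at scale
`2^{-n}` around the point `x_k` of a lattice of mesh `2^{-n}`. As `n → ∞`, the sums
`h ↦ ∑_k F_{x_k}(ψ_k h)` form a Cauchy sequence, since `γ > 0`, and the limit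
reconstructs the germ (`StronglyCoherent.exists_stronglyReconstructs`).

*Uniqueness.* The difference `T` of two reconstructions satisfies `|T(f_x^s)| ≤ C s^γ` locally
uniformly in `x`. Since `γ > 0`, mollifying `h` with `f_s` gives `T h = lim T(f_s ∗ h) = 0`
(`IsKernel.apply_eq_zero`). Applied on the overlaps of charts, this glues the chartwise
reconstructions to a distribution on `M`; applied in the charts of an atlas, it shows that a
reconstruction with respect to that atlas is unique. The glued distribution does not involve an
atlas, so it is the reconstruction for each of the two.
-/

noncomputable section

namespace GermReconstruction

open Set Filter Topology MeasureTheory Metric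

/-! ### Scaled derivative bounds, test functions and functionals of locally finite order -/

section Basic

variable {𝕜 : Type*} [RCLike 𝕜] {d : ℕ}

/-- `DerivBound r l B g`: the derivatives of `g` of order `i ≤ r` are bounded by `B l^{-i}`, as is
natural for a function living at the length scale `l`. -/
def DerivBound {V : Type*} [NormedAddCommGroup V] [NormedSpace ℝ V] (r : ℕ) (l B : ℝ)
    (g : E d → V) : Prop :=
  ∀ i ≤ r, ∀ y, ‖iteratedFDeriv ℝ i g y‖ ≤ B * l⁻¹ ^ i

/-- Smooth functions with compact support contained in `W`, unbundled. -/
structure IsTest (W : Set (E d)) (g : E d → 𝕜) : Prop where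
  contDiff : ContDiff ℝ ∞ g
  compact : HasCompactSupport g
  subset : tsupport g ⊆ W

/-- `T` restricts to a distribution on `W`: it is linear on the test functions on `W`, and on the
test functions supported in a given compact subset of `W` it is bounded by a `C^m` norm. The values
of `T` at other functions are irrelevant. -/
structure IsDistrOn (T : (E d → 𝕜) → 𝕜) (W : Set (E d)) : Prop where
  map_add : ∀ f g, IsTest W f → IsTest W g → T (f + g) = T f + T g
  map_smul : ∀ (c : 𝕜) f, IsTest W f → T (c • f) = c * T f
  bound : ∀ K : Set (E d), IsCompact K → K ⊆ W → ∃ m : ℕ, ∃ C : ℝ, 0 ≤ C ∧ ∀ g, ContDiff ℝ ∞ g →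
    tsupport g ⊆ K → ∀ B, DerivBound m 1 B g → ‖T g‖ ≤ C * B

section DerivBound

variable {V : Type*} [NormedAddCommGroup V] [NormedSpace ℝ V] {r r' : ℕ} {l l' B B' c : ℝ}
  {g h : E d → V}

lemma DerivBound.norm_le (hg : DerivBound r l B g) (y : E d) : ‖g y‖ ≤ B := by
  simpa using hg 0 (Nat.zero_le _) y

lemma DerivBound.nonneg (hg : DerivBound r l B g) : 0 ≤ B :=
  (norm_nonneg _).trans (hg.norm_le 0)

lemma DerivBound.order_mono (hg : DerivBound r l B g) (h : r' ≤ r) : DerivBound r' l B g :=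
  fun i hi y => hg i (hi.trans h) y

lemma DerivBound.scale_mono (hg : DerivBound r l' B g) (hl : 0 < l) (h : l ≤ l') :
    DerivBound r l B g := by
  have := hg.nonneg
  have hl' : 0 < l' := hl.trans_le h
  exact fun i hi y => (hg i hi y).trans (by gcongr)

lemma DerivBound.mul_scale (hg : DerivBound r l B g) (hl : 0 < l) (hc : 1 ≤ c) :
    DerivBound r (c * l) (c ^ r * B) g := by
  intro i hi y
  have h0 := hg.nonneg
  have hc0 : 0 < c := by linarith
  calc _ ≤ B * l⁻¹ ^ i := hg i hi y
    _ = c ^ i * B * (c * l)⁻¹ ^ i := by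
        rw [inv_pow, inv_pow, mul_pow]; field_simp
    _ ≤ c ^ r * B * (c * l)⁻¹ ^ i := by gcongr

lemma DerivBound.smul {A : ℝ} {f : E d → ℝ} (hf : DerivBound r l A f) (hg : DerivBound r l B g)
    (hf' : ContDiff ℝ ∞ f) (hg' : ContDiff ℝ ∞ g) (hl : 0 < l) :
    DerivBound r l (2 ^ r * A * B) (fun y => f y • g y) := by
  intro i hi y
  have hA := hf.nonneg
  have hB := hg.nonneg
  refine (norm_iteratedFDeriv_smul_le hf' hg' y (n := i) (mod_cast le_top)).trans ?_
  calc _ ≤ ∑ j ∈ Finset.range (i + 1), (i.choose j : ℝ) * (A * B * l⁻¹ ^ i) := by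
        refine Finset.sum_le_sum fun j hj => ?_
        have hj' : j ≤ i := by simpa [Nat.lt_succ_iff] using hj
        rw [mul_assoc]
        refine mul_le_mul_of_nonneg_left ?_ (by positivity)
        calc _ ≤ (A * l⁻¹ ^ j) * (B * l⁻¹ ^ (i - j)) :=
              mul_le_mul (hf j (hj'.trans hi) y) (hg _ ((Nat.sub_le _ _).trans hi) y)
                (norm_nonneg _) (by positivity)
          _ = A * B * (l⁻¹ ^ j * l⁻¹ ^ (i - j)) := by ring
          _ = _ := by rw [← pow_add, Nat.add_sub_cancel' hj']
    _ = 2 ^ i * A * B * l⁻¹ ^ i := by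
        rw [← Finset.sum_mul, ← Nat.cast_sum, Nat.sum_range_choose]; push_cast; ring
    _ ≤ _ := by gcongr; norm_num

lemma DerivBound.comp_smul_sub (hg : DerivBound r l B g) (hg' : ContDiff ℝ ∞ g) {s : ℝ}
    (hs : 0 < s) (hl : 0 < l) (x : E d) :
    DerivBound r (s * l) B (fun y => g (s⁻¹ • (y - x))) := by
  intro i hi y
  have h1 : iteratedFDeriv ℝ i (fun y => g (s⁻¹ • (y - x))) y =
      iteratedFDeriv ℝ i (g ∘ (s⁻¹ • ContinuousLinearMap.id ℝ (E d))) (y - x) := by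
    have := congrFun (iteratedFDeriv_comp_sub' (𝕜 := ℝ)
      (f := g ∘ (s⁻¹ • ContinuousLinearMap.id ℝ (E d))) i x) y
    simpa using this
  rw [h1, ContinuousLinearMap.iteratedFDeriv_comp_right _ (hg'.of_le (mod_cast le_top)) _
    (le_refl (i : ℕ∞ω))]
  refine (ContinuousMultilinearMap.norm_compContinuousLinearMap_le _ _).trans ?_
  have hn : ‖s⁻¹ • ContinuousLinearMap.id ℝ (E d)‖ ≤ s⁻¹ := by
    rw [norm_smul, Real.norm_of_nonneg (by positivity)]
    exact mul_le_of_le_one_right (by positivity) ContinuousLinearMap.norm_id_le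
  have hB := hg.nonneg
  calc _ ≤ (B * l⁻¹ ^ i) * ∏ _j : Fin i, s⁻¹ := by
        gcongr
        exact hg i hi _
    _ = _ := by simp [mul_pow]; ring

lemma exists_derivBound (hg : ContDiff ℝ ∞ g) (hg' : HasCompactSupport g) (r : ℕ) (hl : 0 < l) :
    ∃ B, DerivBound r l B g := by
  have h : ∀ i : ℕ, ∃ B, 0 ≤ B ∧ ∀ y, ‖iteratedFDeriv ℝ i g y‖ ≤ B * l⁻¹ ^ i := by
    intro i
    obtain ⟨C, hC⟩ := (hg.continuous_iteratedFDeriv (m := i)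
      (mod_cast le_top)).bounded_above_of_compact_support (hg'.iteratedFDeriv i)
    have hC0 : 0 ≤ C := (norm_nonneg _).trans (hC 0)
    refine ⟨C * l ^ i, by positivity, fun y => (hC y).trans (le_of_eq ?_)⟩
    rw [inv_pow]; field_simp
  choose B hB0 hB using h
  refine ⟨∑ i ∈ Finset.range (r + 1), B i, fun i hi y => (hB i y).trans ?_⟩
  gcongr
  exact Finset.single_le_sum (fun j _ => hB0 j) (Finset.mem_range.2 (Nat.lt_succ_of_le hi))

end DerivBound

section IsTest

variable {W W' : Set (E d)} {f g : E d → 𝕜}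

lemma IsTest.mono (hf : IsTest W f) (h : W ⊆ W') : IsTest W' f :=
  ⟨hf.1, hf.2, hf.3.trans h⟩

lemma IsTest.of_subset_compact (hf : ContDiff ℝ ∞ f) {K : Set (E d)} (hK : IsCompact K)
    (hfK : tsupport f ⊆ K) (hKW : K ⊆ W) : IsTest W f :=
  ⟨hf, hK.of_isClosed_subset (isClosed_tsupport f) hfK, hfK.trans hKW⟩

lemma IsTest.add (hf : IsTest W f) (hg : IsTest W g) : IsTest W (f + g) :=
  ⟨hf.1.add hg.1, hf.2.add hg.2, (tsupport_add f g).trans (union_subset hf.3 hg.3)⟩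

lemma IsTest.const_smul (c : 𝕜) (hf : IsTest W f) : IsTest W (c • f) :=
  ⟨contDiff_const.smul hf.1, hf.2.mono (Function.support_const_smul_subset c f),
    (closure_mono (Function.support_const_smul_subset c f)).trans hf.3⟩

lemma IsTest.sub (hf : IsTest W f) (hg : IsTest W g) : IsTest W (f - g) := by
  simpa [sub_eq_add_neg] using hf.add (hg.const_smul (-1))

lemma IsTest.zero : IsTest W (0 : E d → 𝕜) :=
  ⟨contDiff_const, .zero, by simp [tsupport]⟩

lemma IsTest.sum {ι : Type*} (s : Finset ι) {f : ι → E d → 𝕜} (hf : ∀ i ∈ s, IsTest W (f i)) :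
    IsTest W (∑ i ∈ s, f i) :=
  Finset.sum_induction f (IsTest W) (fun _ _ => IsTest.add) IsTest.zero hf

lemma tsupport_real_smul_subset (θ : E d → ℝ) (g : E d → 𝕜) :
    tsupport (fun y => θ y • g y) ⊆ tsupport θ ∩ tsupport g :=
  subset_inter (closure_mono (Function.support_smul_subset_left θ g))
    (closure_mono (Function.support_smul_subset_right θ g))

lemma IsTest.real_smul {θ : E d → ℝ} (hθ : ContDiff ℝ ∞ θ) (hf : IsTest W f) :
    IsTest W (fun y => θ y • f y) :=
  ⟨hθ.smul hf.1, hf.2.mono (Function.support_smul_subset_right θ f),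
    ((tsupport_real_smul_subset θ f).trans inter_subset_right).trans hf.3⟩

lemma IsTest.exists_derivBound (hf : IsTest W f) (r : ℕ) {l : ℝ} (hl : 0 < l) :
    ∃ B, DerivBound r l B f :=
  GermReconstruction.exists_derivBound hf.1 hf.2 r hl

end IsTest

section IsDistrOn

variable {W W' : Set (E d)} {S T : (E d → 𝕜) → 𝕜} {f g : E d → 𝕜}

lemma IsDistrOn.map_zero (hT : IsDistrOn T W) : T 0 = 0 := by
  simpa using hT.map_smul 0 0 IsTest.zero

lemma IsDistrOn.map_sub (hT : IsDistrOn T W) (hf : IsTest W f) (hg : IsTest W g) :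
    T (f - g) = T f - T g := by
  have := hT.map_add f ((-1 : 𝕜) • g) hf (hg.const_smul (-1))
  rw [hT.map_smul _ _ hg] at this
  simpa [sub_eq_add_neg] using this

lemma IsDistrOn.map_sum (hT : IsDistrOn T W) {ι : Type*} (s : Finset ι) {f : ι → E d → 𝕜}
    (hf : ∀ i ∈ s, IsTest W (f i)) : T (∑ i ∈ s, f i) = ∑ i ∈ s, T (f i) := by
  classical
  induction s using Finset.induction_on with
  | empty => simpa using hT.map_zero
  | insert a s ha ih =>
    rw [Finset.sum_insert ha, Finset.sum_insert ha, hT.map_add _ _ (hf _ (by simp))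
      (IsTest.sum s fun i hi => hf i (by simp [hi])), ih fun i hi => hf i (by simp [hi])]

lemma IsDistrOn.mono (hT : IsDistrOn T W) (h : W' ⊆ W) : IsDistrOn T W' :=
  ⟨fun f g hf hg => hT.map_add f g (hf.mono h) (hg.mono h),
    fun c f hf => hT.map_smul c f (hf.mono h), fun K hK hKW => hT.bound K hK (hKW.trans h)⟩

lemma IsDistrOn.sub (hS : IsDistrOn S W) (hT : IsDistrOn T W) :
    IsDistrOn (fun f => S f - T f) W := by
  refine ⟨fun f g hf hg => ?_, fun c f hf => ?_, fun K hK hKW => ?_⟩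
  · simp only [hS.map_add f g hf hg, hT.map_add f g hf hg]; ring
  · simp only [hS.map_smul c f hf, hT.map_smul c f hf]; ring
  · obtain ⟨m, C, hC, h⟩ := hS.bound K hK hKW
    obtain ⟨m', C', hC', h'⟩ := hT.bound K hK hKW
    refine ⟨max m m', C + C', by positivity, fun g hg hgK B hB => ?_⟩
    rw [add_mul]
    exact (norm_sub_le _ _).trans (add_le_add (h g hg hgK B (hB.order_mono (le_max_left _ _)))
      (h' g hg hgK B (hB.order_mono (le_max_right _ _))))

end IsDistrOn

/-! ### Distributions as functionals on all functions -/

section Extension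

variable {Ω : TopologicalSpace.Opens (E d)}

/-- An unbundled test function on `Ω` as an element of `𝓓(Ω, 𝕜)`. -/
def IsTest.toTestFunction {f : E d → 𝕜} (hf : IsTest (Ω : Set (E d)) f) : 𝓓(Ω, 𝕜) :=
  ⟨f, hf.1, hf.2, hf.3⟩

lemma isTest_coe (f : 𝓓(Ω, 𝕜)) : IsTest (Ω : Set (E d)) (f : E d → 𝕜) :=
  ⟨f.contDiff, f.hasCompactSupport, f.tsupport_subset⟩

open Classical in
/-- A distribution on `Ω`, regarded as a map on all functions; it takes the value zero at functions
that are not test functions on `Ω`. -/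
def Distr.ext (t : Distr 𝕜 Ω) (f : E d → 𝕜) : 𝕜 :=
  if hf : IsTest (Ω : Set (E d)) f then t hf.toTestFunction else 0

lemma Distr.ext_of_isTest (t : Distr 𝕜 Ω) {f : E d → 𝕜} (hf : IsTest (Ω : Set (E d)) f) :
    Distr.ext t f = t hf.toTestFunction := by
  simp [Distr.ext, hf]

lemma Distr.ext_coe (t : Distr 𝕜 Ω) (f : 𝓓(Ω, 𝕜)) : Distr.ext t f = t f := by
  rw [Distr.ext_of_isTest t (isTest_coe f)]; rfl

lemma Distr.ext_eq (t : Distr 𝕜 Ω) {f : E d → 𝕜} (g : 𝓓(Ω, 𝕜)) (h : ∀ y, g y = f y) :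
    Distr.ext t f = t g := by
  rw [← Distr.ext_coe, funext h]

lemma Distr.isDistrOn_ext (t : Distr 𝕜 Ω) : IsDistrOn (Distr.ext t) (Ω : Set (E d)) := by
  refine ⟨fun f g hf hg => ?_, fun c f hf => ?_, fun K hK hKW => ?_⟩
  · rw [Distr.ext_of_isTest t hf, Distr.ext_of_isTest t hg, ← _root_.map_add]
    exact Distr.ext_eq t _ fun _ => rfl
  · rw [Distr.ext_of_isTest t hf, ← smul_eq_mul, ← _root_.map_smul]
    exact Distr.ext_eq t _ fun _ => rfl
  · let K' : TopologicalSpace.Compacts (E d) := ⟨K, hK⟩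
    let L := t ∘L TestFunction.ofSupportedInCLM (n := ⊤) 𝕜 (K := K') hKW
    obtain ⟨s, C, -, hC⟩ := Seminorm.bound_of_continuous
      (ContDiffMapSupportedIn.withSeminorms 𝕜 (E d) 𝕜 ⊤ K')
      ((normSeminorm 𝕜 𝕜).comp L.toLinearMap) (L.continuous.norm)
    refine ⟨s.sup id, C, C.2, fun g hg hgK B hB => ?_⟩
    have hB0 := hB.nonneg
    have hgt : IsTest (Ω : Set (E d)) g := .of_subset_compact hg hK hgK hKW
    let g' : 𝓓_{K'}(E d, 𝕜) := ⟨g, hg, fun x hx => by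
      by_contra h
      exact hx (hgK (subset_tsupport _ h))⟩
    have h1 := hC g'
    have h2 : ‖L g'‖ ≤ C * (s.sup (ContDiffMapSupportedIn.seminorm 𝕜 (E d) 𝕜 ⊤ K')) g' := h1
    have h3 : Distr.ext t g = L g' := Distr.ext_eq t (TestFunction.ofSupportedIn hKW g') fun _ => rfl
    rw [h3]
    refine h2.trans ?_
    gcongr
    refine Seminorm.finset_sup_apply_le hB0 fun i hi => ?_
    rw [ContDiffMapSupportedIn.seminorm_top_le_iff 𝕜 hB0]
    intro x _
    have h4 := hB i (Finset.le_sup (f := id) hi) x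
    rwa [inv_one, one_pow, mul_one] at h4

/-- The distribution on `Ω` defined by a functional of locally finite order. -/
def IsDistrOn.toDistr {T : (E d → 𝕜) → 𝕜} (hT : IsDistrOn T (Ω : Set (E d))) : Distr 𝕜 Ω :=
  TestFunction.mkCLM 𝕜 (fun f => T f) (fun f g => hT.map_add f g (isTest_coe f) (isTest_coe g))
    (fun c f => hT.map_smul c f (isTest_coe f)) fun K hK => by
      obtain ⟨m, C, hC, h⟩ := hT.bound K K.isCompact hK
      let A : 𝓓_{K}(E d, 𝕜) →L[𝕜] 𝕜 := ContDiffMapSupportedIn.mkCLMtoNormedSpace 𝕜 (fun f => T f)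
        (fun f g => hT.map_add f g (isTest_coe (TestFunction.ofSupportedIn hK f))
          (isTest_coe (TestFunction.ofSupportedIn hK g)))
        (fun c f => hT.map_smul c f (isTest_coe (TestFunction.ofSupportedIn hK f)))
        ⟨Finset.range (m + 1), C, hC, fun f => h f f.contDiff f.tsupport_subset _ fun i hi y => by
          simp only [inv_one, one_pow, mul_one]
          refine (ContDiffMapSupportedIn.norm_iteratedFDeriv_apply_le_seminorm_top 𝕜).trans ?_
          exact Seminorm.le_finset_sup_apply (Finset.mem_range.2 (Nat.lt_succ_of_le hi))⟩
      exact A.continuous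

lemma IsDistrOn.toDistr_apply {T : (E d → 𝕜) → 𝕜} (hT : IsDistrOn T (Ω : Set (E d)))
    (f : 𝓓(Ω, 𝕜)) : hT.toDistr f = T f := rfl

lemma IsDistrOn.ext_toDistr {T : (E d → 𝕜) → 𝕜} (hT : IsDistrOn T (Ω : Set (E d)))
    {f : E d → 𝕜} (hf : IsTest (Ω : Set (E d)) f) : Distr.ext hT.toDistr f = T f := by
  rw [Distr.ext_of_isTest _ hf]; rfl

end Extension

end Basic

end GermReconstruction

end

noncomputable section

namespace GermReconstruction

open Set Filter Topology MeasureTheory Metric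

/-! ### Averages of translates -/

section Average

variable {𝕜 : Type*} [RCLike 𝕜] {d : ℕ}

/-- The weighted average `∫ w(y) g(· - p(y)) dy` of translates of `g`. For `p = id` it is a
convolution, for a simple function `p` it is a finite linear combination of translates of `g`. -/
def average (w : E d → 𝕜) (p : E d → E d) (g : E d → 𝕜) (x : E d) : 𝕜 :=
  ∫ y, w y • g (x - p y)

lemma integrable_smul_comp {V : Type*} [NormedAddCommGroup V] [NormedSpace 𝕜 V] {w : E d → 𝕜}
    (hw : Integrable w) {p : E d → E d} (hp : Measurable p) {G : E d → V} (hG : Continuous G)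
    {C : ℝ} (hC : ∀ x, ‖G x‖ ≤ C) (x : E d) : Integrable fun y => w y • G (x - p y) := by
  refine (hw.norm.mul_const C).mono' (hw.aestronglyMeasurable.smul
    (hG.comp_stronglyMeasurable (stronglyMeasurable_const.sub hp.stronglyMeasurable)).aestronglyMeasurable)
    (Eventually.of_forall fun y => ?_)
  rw [norm_smul]
  gcongr
  exact hC _

lemma exists_norm_iteratedFDeriv_le {g : E d → 𝕜} (hg : ContDiff ℝ ∞ g)
    (hg' : HasCompactSupport g) (i : ℕ) : ∃ C, ∀ x, ‖iteratedFDeriv ℝ i g x‖ ≤ C := by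
  obtain ⟨B, hB⟩ := exists_derivBound hg hg' i one_pos
  exact ⟨B, fun x => by simpa using hB i le_rfl x⟩

lemma continuous_iteratedFDeriv_of_smooth {g : E d → 𝕜} (hg : ContDiff ℝ ∞ g) (i : ℕ) :
    Continuous (iteratedFDeriv ℝ i g) :=
  hg.continuous_iteratedFDeriv (mod_cast le_top)

lemma hasFTaylorSeriesUpTo_average {w : E d → 𝕜} (hw : Integrable w) {p : E d → E d}
    (hp : Measurable p) {g : E d → 𝕜} (hg : ContDiff ℝ ∞ g) (hg' : HasCompactSupport g) :
    HasFTaylorSeriesUpTo ∞ (average w p g)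
      (fun x i => ∫ y, w y • iteratedFDeriv ℝ i g (x - p y)) := by
  have hint : ∀ i x, Integrable fun y => w y • iteratedFDeriv ℝ i g (x - p y) := fun i x => by
    obtain ⟨C, hC⟩ := exists_norm_iteratedFDeriv_le hg hg' i
    exact integrable_smul_comp hw hp (continuous_iteratedFDeriv_of_smooth hg i) hC x
  have hder : ∀ i x, HasFDerivAt (fun x => ∫ y, w y • iteratedFDeriv ℝ i g (x - p y))
      (∫ y, w y • iteratedFDeriv ℝ (i + 1) g (x - p y)).curryLeft x := by
    intro i x
    obtain ⟨C, hC⟩ := exists_norm_iteratedFDeriv_le hg hg' (i + 1)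
    have hgi : ∀ z, HasFDerivAt (iteratedFDeriv ℝ i g) (iteratedFDeriv ℝ (i + 1) g z).curryLeft z :=
      fun z => (contDiff_iff_ftaylorSeries.1 hg).fderiv i (mod_cast WithTop.coe_lt_top _) z
    have hcl : (∫ y, w y • iteratedFDeriv ℝ (i + 1) g (x - p y)).curryLeft =
        ∫ y, (w y • iteratedFDeriv ℝ (i + 1) g (x - p y)).curryLeft := by
      let L : (E d [×(i + 1)]→L[ℝ] 𝕜) →L[ℝ] (E d →L[ℝ] (E d [×i]→L[ℝ] 𝕜)) :=
        (continuousMultilinearCurryLeftEquiv ℝ (fun _ : Fin (i + 1) => E d)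
          𝕜).toContinuousLinearEquiv.toContinuousLinearMap
      exact (ContinuousLinearMap.integral_comp_comm (𝕜 := ℝ)
        (Fₗ := E d →L[ℝ] (E d [×i]→L[ℝ] 𝕜)) L (hint (i + 1) x)).symm
    rw [hcl]
    refine hasFDerivAt_integral_of_dominated_of_fderiv_le (bound := fun y => ‖w y‖ * C)
      (s := univ) (F' := fun x y => (w y • iteratedFDeriv ℝ (i + 1) g (x - p y)).curryLeft)
      univ_mem
      (Eventually.of_forall fun x' => (hint i x').aestronglyMeasurable) (hint i x)
      ?_ ?_ (hw.norm.mul_const C) ?_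
    · exact (continuousMultilinearCurryLeftEquiv ℝ (fun _ : Fin (i + 1) => E d)
        𝕜).continuous.comp_aestronglyMeasurable (hint (i + 1) x).aestronglyMeasurable
    · refine Eventually.of_forall fun y x' _ => ?_
      rw [ContinuousMultilinearMap.curryLeft_norm, norm_smul]
      gcongr
      exact hC _
    · refine Eventually.of_forall fun y x' _ => ?_
      exact ((hgi (x' - p y)).comp x' ((hasFDerivAt_id x').sub_const (p y))).const_smul (w y)
  refine ⟨fun x => ?_, fun i _ x => hder i x, fun i _ => ?_⟩
  · have := (continuousMultilinearCurryFin0 ℝ (E d)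
        𝕜).toContinuousLinearEquiv.integral_comp_comm
        (fun y => w y • iteratedFDeriv ℝ 0 g (x - p y)) (μ := volume)
    exact this.symm
  · exact continuous_iff_continuousAt.2 fun x => (hder i x).continuousAt

lemma contDiff_average {w : E d → 𝕜} (hw : Integrable w) {p : E d → E d}
    (hp : Measurable p) {g : E d → 𝕜} (hg : ContDiff ℝ ∞ g) (hg' : HasCompactSupport g) :
    ContDiff ℝ ∞ (average w p g) :=
  (hasFTaylorSeriesUpTo_average hw hp hg hg').contDiff

lemma iteratedFDeriv_average {w : E d → 𝕜} (hw : Integrable w) {p : E d → E d}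
    (hp : Measurable p) {g : E d → 𝕜} (hg : ContDiff ℝ ∞ g) (hg' : HasCompactSupport g)
    (i : ℕ) (x : E d) :
    iteratedFDeriv ℝ i (average w p g) x = ∫ y, w y • iteratedFDeriv ℝ i g (x - p y) :=
  ((hasFTaylorSeriesUpTo_average hw hp hg hg').eq_iteratedFDeriv (mod_cast le_top) x).symm

/-- On a nonempty compact set, the identity is uniformly close to a simple function. -/
lemma exists_simpleFunc_dist_lt {K : Set (E d)} (hK : IsCompact K) (hne : K.Nonempty) {δ : ℝ}
    (hδ : 0 < δ) : ∃ p : SimpleFunc (E d) (E d), (∀ y, p y ∈ K) ∧ ∀ y ∈ K, dist (p y) y < δ := by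
  obtain ⟨t, htK, htf, ht⟩ := hK.finite_cover_balls hδ
  have htne : t.Nonempty := by
    by_contra h
    obtain ⟨x, hx⟩ := hne
    simpa [not_nonempty_iff_eq_empty.1 h] using ht hx
  obtain ⟨e, he⟩ := htf.countable.exists_eq_range htne
  have hk : ∀ z ∈ t, ∃ k, e k = z := fun z hz => by rwa [he] at hz
  choose! k hk using hk
  obtain ⟨N, hN⟩ := (htf.image k).bddAbove
  refine ⟨SimpleFunc.nearestPt e N, fun y => ?_, fun y hy => ?_⟩
  · exact htK (he ▸ ⟨SimpleFunc.nearestPtInd e N y, rfl⟩)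
  · obtain ⟨z, hz, hyz⟩ := mem_iUnion₂.1 (ht hy)
    have h1 := SimpleFunc.edist_nearestPt_le e y (hN (mem_image_of_mem k hz))
    rw [hk z hz, edist_dist, edist_dist, ENNReal.ofReal_le_ofReal_iff dist_nonneg] at h1
    exact h1.trans_lt (by rwa [dist_comm])

/-- For a simple function `p`, the value of `T` at the average is a finite linear combination of
its values at translates. -/
lemma norm_apply_average_simpleFunc_le {W : Set (E d)} {T : (E d → 𝕜) → 𝕜} (hT : IsDistrOn T W)
    {w : E d → 𝕜} (hw : Integrable w) (p : SimpleFunc (E d) (E d)) {φ : E d → 𝕜} {A : ℝ}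
    (hφ : ∀ y, IsTest W fun x => φ (x - p y)) (hA : ∀ y, ‖T fun x => φ (x - p y)‖ ≤ A) :
    ‖T (average w p φ)‖ ≤ A * ∫ y, ‖w y‖ := by
  classical
  have hmeas : ∀ z, MeasurableSet (p ⁻¹' {z}) := p.measurableSet_fiber
  have hi : ∀ z, Integrable ((p ⁻¹' {z}).indicator w) := fun z => hw.indicator (hmeas z)
  have hpart : ∀ (h : E d → E d → 𝕜) (y), h (p y) y =
      ∑ z ∈ p.range, (p ⁻¹' {z}).indicator (h z) y := by
    intro h y
    rw [Finset.sum_eq_single (p y)]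
    · simp
    · intro z _ hz
      exact indicator_of_notMem (fun h => hz h.symm) _
    · intro h; exact absurd (p.mem_range_self y) h
  have hav : average w p φ =
      ∑ z ∈ p.range, (∫ y, (p ⁻¹' {z}).indicator w y) • fun x => φ (x - z) := by
    ext x
    simp only [average, Finset.sum_apply, Pi.smul_apply]
    simp_rw [← integral_smul_const]
    rw [← integral_finsetSum _ fun z _ => (hi z).smul_const _]
    refine integral_congr_ae (Eventually.of_forall fun y => ?_)
    simp only
    rw [hpart (fun z y => w y • φ (x - z)) y]
    refine Finset.sum_congr rfl fun z _ => ?_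
    by_cases hz : y ∈ p ⁻¹' {z} <;> simp [hz]
  have htest : ∀ z ∈ p.range, IsTest W fun x => φ (x - z) := by
    intro z hz
    obtain ⟨y, rfl⟩ := p.mem_range.1 hz
    exact hφ y
  rw [hav, hT.map_sum _ fun z hz => (htest z hz).const_smul _]
  have hA0 : 0 ≤ A := (norm_nonneg _).trans (hA 0)
  calc _ ≤ ∑ z ∈ p.range, A * ∫ y, (p ⁻¹' {z}).indicator (fun y => ‖w y‖) y := by
        refine norm_sum_le_of_le _ fun z hz => ?_
        rw [hT.map_smul _ _ (htest z hz), norm_mul, mul_comm]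
        obtain ⟨y, rfl⟩ := p.mem_range.1 hz
        gcongr
        · exact hA y
        · refine (norm_integral_le_integral_norm _).trans (le_of_eq ?_)
          simp_rw [norm_indicator_eq_indicator_norm]
    _ = A * ∫ y, ‖w y‖ := by
        rw [← Finset.mul_sum, ← integral_finsetSum _ fun z _ => hw.norm.indicator (hmeas z)]
        congr 2 with y
        rw [Finset.sum_eq_single (p y)]
        · simp
        · intro z _ hz
          exact indicator_of_notMem (fun h => hz h.symm) _
        · intro h; exact absurd (p.mem_range_self y) h

/-- A distribution satisfies the triangle inequality for integrals of translates of a test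
function: the integral is a limit of averages over finitely many translates in each `C^m` norm. -/
lemma norm_apply_average_le {W : Set (E d)} {T : (E d → 𝕜) → 𝕜} (hT : IsDistrOn T W)
    {w : E d → 𝕜} (hw : Integrable w) {φ : E d → 𝕜} (hφ : ContDiff ℝ ∞ φ)
    (hφ' : HasCompactSupport φ) {K K' : Set (E d)} (hK : IsCompact K) (hK' : IsCompact K')
    (hKW : K' ⊆ W) (hwK : ∀ y ∉ K, w y = 0) (hKK' : ∀ y ∈ K, ∀ x, φ (x - y) ≠ 0 → x ∈ K') {A : ℝ}
    (hA0 : 0 ≤ A) (hA : ∀ y ∈ K, ‖T fun x => φ (x - y)‖ ≤ A) :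
    ‖T (average w id φ)‖ ≤ A * ∫ y, ‖w y‖ := by
  have hI : 0 ≤ ∫ y, ‖w y‖ := integral_nonneg fun _ => norm_nonneg _
  rcases K.eq_empty_or_nonempty with rfl | hne
  · have : average w id φ = 0 := by
      ext x; simp [average, fun y => hwK y (notMem_empty y)]
    rw [this, hT.map_zero, norm_zero]; positivity
  obtain ⟨m, C, hC, hm⟩ := hT.bound K' hK' hKW
  have hKt : ∀ f : E d → 𝕜, (∀ x, f x ≠ 0 → x ∈ K') → tsupport f ⊆ K' := fun f hf =>
    closure_minimal hf hK'.isClosed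
  have hsupp : ∀ q : E d → E d, (∀ y ∈ K, q y ∈ K) → ∀ x, average w q φ x ≠ 0 → x ∈ K' := by
    intro q hq x hx
    by_contra h
    refine hx (integral_eq_zero_of_ae (Eventually.of_forall fun y => ?_))
    by_cases hy : y ∈ K
    · have : φ (x - q y) = 0 := by
        by_contra h0; exact h (hKK' _ (hq y hy) x h0)
      simp [this]
    · simp [hwK y hy]
  refine le_of_forall_pos_le_add fun ε hε => ?_
  obtain ⟨ε', hε', hεε⟩ : ∃ ε' > 0, C * (ε' * ∫ y, ‖w y‖) ≤ ε := by
    refine ⟨ε / (C * (∫ y, ‖w y‖) + 1), by positivity, ?_⟩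
    rw [← mul_assoc, mul_comm C, mul_assoc, div_mul_eq_mul_div, div_le_iff₀ (by positivity)]
    nlinarith
  obtain ⟨δ, hδ, hδφ⟩ : ∃ δ > 0, ∀ i ≤ m, ∀ u v : E d, dist u v < δ →
      dist (iteratedFDeriv ℝ i φ u) (iteratedFDeriv ℝ i φ v) < ε' := by
    have h : ∀ i : ℕ, ∃ δ > 0, ∀ u v : E d, dist u v < δ →
        dist (iteratedFDeriv ℝ i φ u) (iteratedFDeriv ℝ i φ v) < ε' := by
      intro i
      have huc : UniformContinuous (iteratedFDeriv ℝ i φ) :=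
        (continuous_iteratedFDeriv_of_smooth hφ i).uniformContinuous_of_tendsto_cocompact
          ((hφ'.iteratedFDeriv i).is_zero_at_infty)
      obtain ⟨δ, hδ, h⟩ := Metric.uniformContinuous_iff.1 huc ε' hε'
      exact ⟨δ, hδ, fun u v huv => h huv⟩
    choose δ hδ h using h
    refine ⟨(Finset.range (m + 1)).inf' ⟨0, by simp⟩ δ, ?_, fun i hi u v huv => h i u v ?_⟩
    · exact (Finset.lt_inf'_iff _).2 fun i _ => hδ i
    · exact huv.trans_le (Finset.inf'_le _ (Finset.mem_range.2 (Nat.lt_succ_of_le hi)))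
  obtain ⟨p, hpK, hp⟩ := exists_simpleFunc_dist_lt hK hne hδ
  have hidc := contDiff_average hw measurable_id hφ hφ'
  have hpc := contDiff_average hw p.measurable hφ hφ'
  have hidt : IsTest W (average w id φ) :=
    .of_subset_compact hidc hK' (hKt _ (hsupp id fun y hy => hy)) hKW
  have hpt : IsTest W (average w p φ) :=
    .of_subset_compact hpc hK' (hKt _ (hsupp p fun y _ => hpK y)) hKW
  have h1 : ‖T (average w p φ)‖ ≤ A * ∫ y, ‖w y‖ := by
    refine norm_apply_average_simpleFunc_le hT hw p (fun y => ?_) fun y => hA _ (hpK y)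
    refine .of_subset_compact (hφ.comp (contDiff_id.sub contDiff_const)) hK' (hKt _ ?_) hKW
    exact fun x hx => hKK' _ (hpK y) x hx
  have h2 : ‖T (average w id φ - average w p φ)‖ ≤ C * (ε' * ∫ y, ‖w y‖) := by
    refine hm _ (hidc.sub hpc) ?_ _ fun i hi x => ?_
    · exact (tsupport_sub _ _).trans (union_subset (hKt _ (hsupp id fun y hy => hy))
        (hKt _ (hsupp p fun y _ => hpK y)))
    · obtain ⟨B, hB⟩ := exists_norm_iteratedFDeriv_le hφ hφ' i
      have hcont := continuous_iteratedFDeriv_of_smooth hφ i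
      change ‖iteratedFDeriv ℝ i (average w id φ - average w p φ) x‖ ≤ _
      rw [iteratedFDeriv_sub_apply (hidc.of_le (mod_cast le_top)).contDiffAt
        (hpc.of_le (mod_cast le_top)).contDiffAt,
        iteratedFDeriv_average hw measurable_id hφ hφ',
        iteratedFDeriv_average hw p.measurable hφ hφ',
        ← integral_sub (integrable_smul_comp hw measurable_id hcont hB x)
          (integrable_smul_comp hw p.measurable hcont hB x), inv_one, one_pow, mul_one,
        ← integral_const_mul]
      refine norm_integral_le_of_norm_le (hw.norm.const_mul _) (Eventually.of_forall fun y => ?_)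
      rw [← smul_sub, norm_smul, mul_comm]
      by_cases hy : y ∈ K
      · gcongr
        rw [← dist_eq_norm]
        refine (hδφ i hi _ _ ?_).le
        rw [dist_sub_left]
        simpa [dist_comm] using hp y hy
      · simp [hwK y hy]
  rw [hT.map_sub hidt hpt] at h2
  calc _ = ‖T (average w p φ) + (T (average w id φ) - T (average w p φ))‖ := by congr 1; ring
    _ ≤ _ := norm_add_le _ _
    _ ≤ _ := by linarith

end Average

end GermReconstruction

end

noncomputable section

namespace GermReconstruction

open Set Filter Topology MeasureTheory Metric

/-! ### Control of a distribution by the rescalings of a single test function -/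

section Smear

variable {𝕜 : Type*} [RCLike 𝕜] {d : ℕ}

/-- The convolution of `g` with `φ` rescaled to the length `s`. -/
def smear (φ : E d → 𝕜) (s : ℝ) (g : E d → 𝕜) : E d → 𝕜 :=
  average φ (fun u => s • u) g

lemma rescale_eq_sub (φ : E d → 𝕜) (y : E d) (s : ℝ) :
    rescale φ y s = fun x => rescale φ 0 s (x - y) := by
  ext x; simp [rescale]

lemma smear_eq_average (φ g : E d → 𝕜) {s : ℝ} (hs : 0 < s) :
    smear φ s g = average g id (rescale φ 0 s) := by
  ext x
  have h1 : average g id (rescale φ 0 s) x =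
      ∫ v, (s ^ d)⁻¹ • (φ (s⁻¹ • v) • g (x - s • s⁻¹ • v)) := by
    rw [average, ← integral_sub_left_eq_self _ volume x]
    refine integral_congr_ae (Eventually.of_forall fun v => ?_)
    simp only [rescale, id, sub_sub_cancel, sub_zero, smul_smul, mul_inv_cancel₀ hs.ne', one_smul]
    rw [smul_comm, smul_eq_mul, smul_eq_mul, mul_comm]
  rw [h1, integral_smul, Measure.integral_comp_smul volume
    (fun u => φ u • g (x - s • u)) s⁻¹, smul_smul, finrank_euclideanSpace_fin,
    abs_of_nonneg (by positivity), inv_pow, inv_inv, inv_mul_cancel₀ (by positivity), one_smul]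
  rfl

lemma contDiff_rescale {φ : E d → 𝕜} (hφ : ContDiff ℝ ∞ φ) (y : E d) (s : ℝ) :
    ContDiff ℝ ∞ (rescale φ y s) := by
  unfold rescale
  fun_prop

lemma mem_closedBall_of_rescale_ne_zero {φ : E d → 𝕜} {R : ℝ}
    (hR : ∀ x, φ x ≠ 0 → ‖x‖ ≤ R) {y : E d} {s : ℝ} (hs : 0 < s) {x : E d}
    (hx : rescale φ y s x ≠ 0) : x ∈ closedBall y (s * R) := by
  have h1 : φ (s⁻¹ • (x - y)) ≠ 0 := fun h => hx (by simp [rescale, h])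
  have h2 := hR _ h1
  rw [norm_smul, Real.norm_of_nonneg (by positivity), inv_mul_le_iff₀ hs] at h2
  rwa [mem_closedBall, dist_eq_norm]

lemma tsupport_rescale_subset {φ : E d → 𝕜} {R : ℝ} (hR : ∀ x, φ x ≠ 0 → ‖x‖ ≤ R)
    (y : E d) {s : ℝ} (hs : 0 < s) : tsupport (rescale φ y s) ⊆ closedBall y (s * R) :=
  closure_minimal (fun _ hx => mem_closedBall_of_rescale_ne_zero hR hs hx) isClosed_closedBall

lemma isTest_rescale {φ : E d → 𝕜} (hφ : ContDiff ℝ ∞ φ) {R : ℝ}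
    (hR : ∀ x, φ x ≠ 0 → ‖x‖ ≤ R) {W : Set (E d)} {y : E d} {s : ℝ} (hs : 0 < s)
    (hW : closedBall y (s * R) ⊆ W) : IsTest W (rescale φ y s) :=
  .of_subset_compact (contDiff_rescale hφ y s) (isCompact_closedBall y _)
    (tsupport_rescale_subset hR y hs) hW

lemma exists_pos_norm_le_of_hasCompactSupport {φ : E d → 𝕜} (hφ' : HasCompactSupport φ) :
    ∃ R, 1 ≤ R ∧ ∀ x, φ x ≠ 0 → ‖x‖ ≤ R := by
  obtain ⟨R, hR⟩ := hφ'.isCompact.isBounded.exists_norm_le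
  exact ⟨max R 1, le_max_right _ _, fun x hx =>
    (hR x (subset_tsupport _ hx)).trans (le_max_left _ _)⟩

/-- The data of an averaging kernel: a test function `φ` of integral one, a bound `R` for its
support and a bound `M` for its `L^1` norm. -/
structure IsKernel (φ : E d → 𝕜) (R M : ℝ) : Prop where
  contDiff : ContDiff ℝ ∞ φ
  compact : HasCompactSupport φ
  integral_eq : ∫ x, φ x = 1
  one_le : 1 ≤ R
  norm_le : ∀ x, φ x ≠ 0 → ‖x‖ ≤ R
  integral_norm_le : ∫ x, ‖φ x‖ ≤ M

lemma exists_isKernel {f : E d → 𝕜} (hf : ContDiff ℝ ∞ f) (hf' : HasCompactSupport f)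
    (h : ∫ x, f x ≠ 0) : ∃ R M, IsKernel ((∫ x, f x)⁻¹ • f) R M := by
  have h1 : ContDiff ℝ ∞ ((∫ x, f x)⁻¹ • f) := contDiff_const.smul hf
  have h2 : HasCompactSupport ((∫ x, f x)⁻¹ • f) :=
    hf'.mono (Function.support_const_smul_subset _ f)
  obtain ⟨R, hR1, hR⟩ := exists_pos_norm_le_of_hasCompactSupport h2
  refine ⟨R, _, h1, h2, ?_, hR1, hR, le_rfl⟩
  simp only [Pi.smul_apply]
  rw [integral_smul, smul_eq_mul, inv_mul_cancel₀ h]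

namespace IsKernel

variable {φ : E d → 𝕜} {R M : ℝ}

lemma integrable (h : IsKernel φ R M) : Integrable φ :=
  h.contDiff.continuous.integrable_of_hasCompactSupport h.compact

lemma nonneg (h : IsKernel φ R M) : 0 ≤ M :=
  (integral_nonneg fun _ => norm_nonneg _).trans h.integral_norm_le

lemma pos (h : IsKernel φ R M) : 0 < R := one_pos.trans_le h.one_le

variable {g : E d → 𝕜}

lemma contDiff_smear (h : IsKernel φ R M) (hg : ContDiff ℝ ∞ g) (hg' : HasCompactSupport g)
    (s : ℝ) : ContDiff ℝ ∞ (smear φ s g) :=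
  contDiff_average h.integrable (measurable_const_smul s) hg hg'

lemma tsupport_smear_subset (h : IsKernel φ R M) {s ρ : ℝ} (hs : 0 < s) {q : E d}
    (hg : tsupport g ⊆ closedBall q ρ) : tsupport (smear φ s g) ⊆ closedBall q (ρ + s * R) := by
  refine closure_minimal (fun x hx => ?_) isClosed_closedBall
  by_contra hxq
  refine hx (integral_eq_zero_of_ae (Eventually.of_forall fun u => ?_))
  by_cases hu : φ u = 0
  · simp [hu]
  · have : g (x - s • u) = 0 := by
      by_contra hgu
      refine hxq ?_
      have h1 := hg (subset_tsupport _ hgu)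
      have h2 := h.norm_le u hu
      rw [mem_closedBall, dist_eq_norm] at h1 ⊢
      calc ‖x - q‖ = ‖(x - s • u - q) + s • u‖ := by congr 1; abel
        _ ≤ ρ + s * R := by
            refine (norm_add_le _ _).trans (add_le_add h1 ?_)
            rw [norm_smul, Real.norm_of_nonneg hs.le]
            gcongr
    simp [this]

lemma iteratedFDeriv_sub_smear (h : IsKernel φ R M) (hg : ContDiff ℝ ∞ g)
    (hg' : HasCompactSupport g) (s : ℝ) (i : ℕ) (x : E d) :
    iteratedFDeriv ℝ i (g - smear φ s g) x =
      ∫ u, φ u • (iteratedFDeriv ℝ i g x - iteratedFDeriv ℝ i g (x - s • u)) := by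
  obtain ⟨B, hB⟩ := exists_norm_iteratedFDeriv_le hg hg' i
  rw [iteratedFDeriv_sub_apply (hg.of_le (mod_cast le_top)).contDiffAt
    ((h.contDiff_smear hg hg' s).of_le (mod_cast le_top)).contDiffAt, smear,
    iteratedFDeriv_average h.integrable (measurable_const_smul s) hg hg']
  simp_rw [smul_sub]
  rw [integral_sub (h.integrable.smul_const _) (integrable_smul_comp h.integrable
    (measurable_const_smul s) (continuous_iteratedFDeriv_of_smooth hg i) hB x),
    integral_smul_const, h.integral_eq, one_smul]

lemma norm_integral_smul_le (h : IsKernel φ R M) {V : Type*} [NormedAddCommGroup V]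
    [NormedSpace ℝ V] [NormedSpace 𝕜 V] {G : E d → V} {a : ℝ}
    (hG : ∀ u, ‖u‖ ≤ R → ‖G u‖ ≤ a) : ‖∫ u, φ u • G u‖ ≤ M * a := by
  have ha : 0 ≤ a := (norm_nonneg _).trans (hG 0 (by simpa using h.pos.le))
  calc _ ≤ ∫ u, ‖φ u‖ * a := by
        refine norm_integral_le_of_norm_le (h.integrable.norm.mul_const a)
          (Eventually.of_forall fun u => ?_)
        rw [norm_smul]
        by_cases hu : φ u = 0
        · simp [hu]
        · gcongr
          exact hG u (h.norm_le u hu)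
    _ ≤ _ := by
        rw [integral_mul_const]
        gcongr
        exact h.integral_norm_le

lemma norm_iteratedFDeriv_sub_smear_le (h : IsKernel φ R M) (hg : ContDiff ℝ ∞ g)
    (hg' : HasCompactSupport g) (s : ℝ) {i : ℕ} {a : ℝ}
    (ha : ∀ x, ‖iteratedFDeriv ℝ i g x‖ ≤ a) (x : E d) :
    ‖iteratedFDeriv ℝ i (g - smear φ s g) x‖ ≤ M * (a + a) := by
  rw [h.iteratedFDeriv_sub_smear hg hg']
  exact h.norm_integral_smul_le fun u _ => (norm_sub_le _ _).trans (add_le_add (ha _) (ha _))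

/-- Smearing at the length `s` changes a function by `O(s)`, at the cost of one derivative. -/
lemma norm_iteratedFDeriv_sub_smear_le_mul (h : IsKernel φ R M) (hg : ContDiff ℝ ∞ g)
    (hg' : HasCompactSupport g) {s : ℝ} (hs : 0 < s) {i : ℕ} {a : ℝ}
    (ha : ∀ x, ‖iteratedFDeriv ℝ (i + 1) g x‖ ≤ a) (x : E d) :
    ‖iteratedFDeriv ℝ i (g - smear φ s g) x‖ ≤ M * (a * (s * R)) := by
  rw [h.iteratedFDeriv_sub_smear hg hg']
  have ha0 : 0 ≤ a := (norm_nonneg _).trans (ha 0)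
  refine h.norm_integral_smul_le fun u hu => ?_
  have hdiff : Differentiable ℝ (iteratedFDeriv ℝ i g) :=
    hg.differentiable_iteratedFDeriv (mod_cast WithTop.coe_lt_top _)
  have h1 := Convex.norm_image_sub_le_of_norm_fderiv_le (𝕜 := ℝ) (C := a) (s := univ)
    (fun z _ => hdiff z) (fun z _ => by
      rw [norm_fderiv_iteratedFDeriv]; exact ha z) convex_univ (mem_univ (x - s • u)) (mem_univ x)
  refine h1.trans ?_
  rw [sub_sub_cancel, norm_smul, Real.norm_of_nonneg hs.le]
  gcongr

/-- If `T` is bounded by `A` on the translates of the rescaled kernel that are centred on the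
support of `g`, then it is bounded by `A ‖g‖_{L^1}` on the smeared function. -/
lemma norm_apply_smear_le (h : IsKernel φ R M) {W : Set (E d)} {T : (E d → 𝕜) → 𝕜}
    (hT : IsDistrOn T W) (hg : ContDiff ℝ ∞ g) {K K' : Set (E d)} (hK : IsCompact K)
    (hK' : IsCompact K') (hKW : K' ⊆ W) (hgK : tsupport g ⊆ K) {s : ℝ} (hs : 0 < s)
    (hKK' : ∀ y ∈ K, closedBall y (s * R) ⊆ K') {A : ℝ} (hA0 : 0 ≤ A)
    (hA : ∀ y ∈ K, ‖T (rescale φ y s)‖ ≤ A) :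
    ‖T (smear φ s g)‖ ≤ A * ∫ y, ‖g y‖ := by
  rw [smear_eq_average φ g hs]
  have hg' : HasCompactSupport g := hK.of_isClosed_subset (isClosed_tsupport _) hgK
  have hsupp := tsupport_rescale_subset h.norm_le 0 hs
  refine norm_apply_average_le hT (hg.continuous.integrable_of_hasCompactSupport hg')
    (contDiff_rescale h.contDiff 0 s) ((isCompact_closedBall _ _).of_isClosed_subset
      (isClosed_tsupport _) hsupp) hK hK' hKW
    (fun y hy => image_eq_zero_of_notMem_tsupport fun hy' => hy (hgK hy'))
    (fun y hy x hx => ?_) hA0 (fun y hy => ?_)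
  · rw [← congrFun (rescale_eq_sub φ y s) x] at hx
    exact hKK' y hy (mem_closedBall_of_rescale_ne_zero h.norm_le hs hx)
  · rw [← rescale_eq_sub φ y s]
    exact hA y hy

end IsKernel

/-- A distribution that decays on the rescalings of one kernel, locally uniformly in the centre,
vanishes: `T g` is the limit of `T (smear φ s g)`. -/
theorem IsKernel.apply_eq_zero {φ : E d → 𝕜} {R M : ℝ} (h : IsKernel φ R M) {W : Set (E d)}
    (hW : IsOpen W) {T : (E d → 𝕜) → 𝕜} (hT : IsDistrOn T W) {γ : ℝ} (hγ : 0 < γ)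
    (hloc : ∀ x₀ ∈ W, ∃ C : ℝ, ∃ η > 0, ∀ y ∈ ball x₀ η, ∀ s ∈ Ioc 0 η,
      ‖T (rescale φ y s)‖ ≤ C * s ^ γ) {g : E d → 𝕜} (hg : IsTest W g) : T g = 0 := by
  obtain ⟨C, η, hη, hC⟩ : ∃ C : ℝ, ∃ η > 0, ∀ y ∈ tsupport g, ∀ s ∈ Ioc 0 η,
      ‖T (rescale φ y s)‖ ≤ C * s ^ γ := by
    refine hg.compact.isCompact.induction_on (p := fun S => ∃ C : ℝ, ∃ η > 0, ∀ y ∈ S,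
      ∀ s ∈ Ioc 0 η, ‖T (rescale φ y s)‖ ≤ C * s ^ γ) ⟨0, 1, one_pos, by simp⟩ ?_ ?_ ?_
    · rintro S S' hS ⟨C, η, hη, hC⟩
      exact ⟨C, η, hη, fun y hy => hC y (hS hy)⟩
    · rintro S S' ⟨C, η, hη, hC⟩ ⟨C', η', hη', hC'⟩
      refine ⟨max C C', min η η', lt_min hη hη', fun y hy s hs => ?_⟩
      have hs0 : 0 ≤ s ^ γ := Real.rpow_nonneg hs.1.le _
      rcases hy with hy | hy
      · exact (hC y hy s ⟨hs.1, hs.2.trans (min_le_left _ _)⟩).trans (by gcongr; exact le_max_left _ _)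
      · exact (hC' y hy s ⟨hs.1, hs.2.trans (min_le_right _ _)⟩).trans
          (by gcongr; exact le_max_right _ _)
    · intro x hx
      obtain ⟨C, η, hη, hC⟩ := hloc x (hg.subset hx)
      exact ⟨ball x η, mem_nhdsWithin_of_mem_nhds (ball_mem_nhds x hη), C, η, hη, hC⟩
  obtain ⟨ρ, hρ, hρW⟩ := hg.compact.isCompact.exists_cthickening_subset_open hW hg.subset
  have hK' : IsCompact (cthickening ρ (tsupport g)) := hg.compact.isCompact.cthickening
  obtain ⟨m, C', hC', hm⟩ := hT.bound _ hK' hρW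
  obtain ⟨B, hB⟩ := hg.exists_derivBound (m + 1) one_pos
  have hB0 := hB.nonneg
  have hR := h.pos
  have hI : 0 ≤ ∫ y, ‖g y‖ := integral_nonneg fun _ => norm_nonneg _
  have key : ∀ᶠ s in 𝓝[>] (0 : ℝ),
      ‖T g‖ ≤ |C| * s ^ γ * (∫ y, ‖g y‖) + C' * (M * (B * (s * R))) := by
    have h1 : Ioo (0 : ℝ) (min η (ρ / R)) ∈ 𝓝[>] (0 : ℝ) :=
      Ioo_mem_nhdsGT (lt_min hη (by positivity))
    filter_upwards [h1] with s hs
    have hs0 := hs.1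
    have hsR : s * R ≤ ρ := by
      rw [← le_div_iff₀ hR]; exact hs.2.le.trans (min_le_right _ _)
    have hsub : ∀ y ∈ tsupport g, closedBall y (s * R) ⊆ cthickening ρ (tsupport g) :=
      fun y hy => (closedBall_subset_closedBall hsR).trans (closedBall_subset_cthickening hy ρ)
    have h2 : ‖T (smear φ s g)‖ ≤ |C| * s ^ γ * ∫ y, ‖g y‖ :=
      h.norm_apply_smear_le hT hg.contDiff hg.compact.isCompact hK' hρW le_rfl hs0 hsub
        (by positivity) fun y hy => (hC y hy s ⟨hs0, hs.2.le.trans (min_le_left _ _)⟩).trans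
          (by gcongr; exact le_abs_self C)
    have hsm : tsupport (smear φ s g) ⊆ cthickening ρ (tsupport g) := by
      refine closure_minimal (fun x hx => ?_) hK'.isClosed
      by_contra hxq
      refine hx (integral_eq_zero_of_ae (Eventually.of_forall fun u => ?_))
      by_cases hu : φ u = 0
      · simp [hu]
      · have : g (x - s • u) = 0 := by
          by_contra hgu
          refine hxq (hsub _ (subset_tsupport _ hgu) ?_)
          rw [mem_closedBall, dist_eq_norm, sub_sub_cancel, norm_smul, Real.norm_of_nonneg hs0.le]
          exact mul_le_mul_of_nonneg_left (h.norm_le u hu) hs0.le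
        simp [this]
    have hst : IsTest W (smear φ s g) :=
      .of_subset_compact (h.contDiff_smear hg.contDiff hg.compact s) hK' hsm hρW
    have h3 : ‖T (g - smear φ s g)‖ ≤ C' * (M * (B * (s * R))) := by
      refine hm _ (hg.contDiff.sub hst.contDiff) ((tsupport_sub _ _).trans (union_subset
        (self_subset_cthickening _) hsm)) _ fun i hi x => ?_
      simp only [inv_one, one_pow, mul_one]
      refine h.norm_iteratedFDeriv_sub_smear_le_mul hg.contDiff hg.compact hs0 (fun x => ?_) x
      simpa using hB (i + 1) (by omega) x
    rw [hT.map_sub hg hst] at h3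
    calc ‖T g‖ = ‖T (smear φ s g) + (T g - T (smear φ s g))‖ := by congr 1; ring
      _ ≤ _ := (norm_add_le _ _).trans (add_le_add h2 h3)
  have hlim : Tendsto (fun s : ℝ => |C| * s ^ γ * (∫ y, ‖g y‖) + C' * (M * (B * (s * R))))
      (𝓝[>] 0) (𝓝 0) := by
    have hc : Continuous fun s : ℝ => |C| * s ^ γ * (∫ y, ‖g y‖) + C' * (M * (B * (s * R))) := by
      have := Real.continuous_rpow_const hγ.le
      fun_prop
    have := (hc.tendsto 0).mono_left (nhdsWithin_le_nhds (s := Ioi 0))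
    simpa [Real.zero_rpow hγ.ne'] using this
  exact norm_le_zero_iff.1 (ge_of_tendsto hlim key)

end Smear

end GermReconstruction

end

noncomputable section

namespace GermReconstruction

open Set Filter Topology MeasureTheory Metric

section Residual

variable {𝕜 : Type*} [RCLike 𝕜] {d : ℕ}

/-- The remainder of `g` after subtracting successively its smeared parts at the lengths
`s 0, …, s (n - 1)`. -/
def residual (φ : E d → 𝕜) (s : ℕ → ℝ) (g : E d → 𝕜) : ℕ → E d → 𝕜
  | 0 => g
  | n + 1 => residual φ s g n - smear φ (s n) (residual φ s g n)

namespace IsKernel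

variable {φ : E d → 𝕜} {R M : ℝ} {g : E d → 𝕜} {q : E d} {l b ε : ℝ}

/-- Along a geometric sequence of lengths, the supports of the residuals stay in a fixed ball. -/
lemma residual_smooth_and_support (h : IsKernel φ R M) (hl : 0 < l) (hb : 0 < b) (hb2 : b ≤ 1 / 2)
    (hε : 0 < ε) (hεR : ε * R ≤ 1 / 2) (hg : ContDiff ℝ ∞ g) (hgq : tsupport g ⊆ closedBall q l)
    (n : ℕ) : ContDiff ℝ ∞ (residual φ (fun n => ε * l * b ^ n) g n) ∧
      tsupport (residual φ (fun n => ε * l * b ^ n) g n) ⊆ closedBall q (l * (2 - b ^ n)) := by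
  induction n with
  | zero => exact ⟨hg, by simpa [residual, show (2 : ℝ) - 1 = 1 by norm_num] using hgq⟩
  | succ n ih =>
    have hc : HasCompactSupport (residual φ (fun n => ε * l * b ^ n) g n) :=
      (isCompact_closedBall _ _).of_isClosed_subset (isClosed_tsupport _) ih.2
    have hpow : 0 < b ^ n := by positivity
    refine ⟨ih.1.sub (h.contDiff_smear ih.1 hc _), (tsupport_sub _ _).trans (union_subset
      (ih.2.trans (closedBall_subset_closedBall ?_))
      ((h.tsupport_smear_subset (by positivity) ih.2).trans (closedBall_subset_closedBall ?_)))⟩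
    · gcongr ?_ * (2 - ?_)
      exact pow_le_pow_of_le_one hb.le (by linarith) (Nat.le_succ n)
    · calc l * (2 - b ^ n) + ε * l * b ^ n * R = l * (2 - b ^ n + (ε * R) * b ^ n) := by ring
        _ ≤ l * (2 - b ^ n + (1 - b) * b ^ n) := by gcongr; linarith
        _ = l * (2 - b ^ (n + 1)) := by ring

/-- Each of the last `k` smearings before the `n`-th residual gains a factor comparable to `b ^ n`,
and costs one derivative; the others cost at most the factor `1 + 2 M + R M`. -/
lemma derivBound_residual (h : IsKernel φ R M) (hl : 0 < l) (hb : 0 < b) (hb2 : b ≤ 1 / 2)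
    (hε : 0 < ε) (hε1 : ε ≤ 1) (hεR : ε * R ≤ 1 / 2) (hg : ContDiff ℝ ∞ g)
    (hgq : tsupport g ⊆ closedBall q l) {r : ℕ} {B : ℝ} (hB : DerivBound r l B g) (k n : ℕ)
    {i : ℕ} (hi : i + k ≤ r) (x : E d) :
    ‖iteratedFDeriv ℝ i (residual φ (fun n => ε * l * b ^ n) g n) x‖ ≤
      B * l⁻¹ ^ i * ((1 + 2 * M + R * M) ^ n * b⁻¹ ^ (k ^ 2) * (b ^ n) ^ k) := by
  have hM := h.nonneg
  have hR := h.pos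
  have hB0 := hB.nonneg
  have hC1 : 1 ≤ 1 + 2 * M + R * M := by nlinarith
  have hbi : 1 ≤ b⁻¹ := (one_le_inv₀ hb).2 (by linarith)
  induction n generalizing i k x with
  | zero =>
    refine (hB i (by omega) x).trans (le_mul_of_one_le_right (by positivity) ?_)
    simpa using one_le_pow₀ hbi
  | succ n ih =>
    obtain ⟨h1, h2⟩ := h.residual_smooth_and_support hl hb hb2 hε hεR hg hgq n
    have hc : HasCompactSupport (residual φ (fun n => ε * l * b ^ n) g n) :=
      (isCompact_closedBall _ _).of_isClosed_subset (isClosed_tsupport _) h2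
    cases k with
    | zero =>
      refine (h.norm_iteratedFDeriv_sub_smear_le h1 hc _ (ih 0 hi) x).trans ?_
      have h3 : 0 ≤ B * l⁻¹ ^ i * (1 + 2 * M + R * M) ^ n := by positivity
      have h4 : 2 * M ≤ 1 + 2 * M + R * M := by nlinarith
      calc _ = B * l⁻¹ ^ i * (1 + 2 * M + R * M) ^ n * (2 * M) := by simp; ring
        _ ≤ B * l⁻¹ ^ i * (1 + 2 * M + R * M) ^ n * (1 + 2 * M + R * M) := by gcongr
        _ = _ := by simp; ring
    | succ k =>
      refine (h.norm_iteratedFDeriv_sub_smear_le_mul h1 hc (by positivity)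
        (ih k (i := i + 1) (by omega)) x).trans ?_
      have hD : b⁻¹ ^ (k ^ 2) ≤ b⁻¹ ^ ((k + 1) ^ 2) * b ^ (k + 1) := by
        have : (k + 1) ^ 2 = k ^ 2 + k + (k + 1) := by ring
        rw [this, pow_add _ (k ^ 2 + k), mul_assoc, ← mul_pow, inv_mul_cancel₀ hb.ne', one_pow,
          mul_one]
        exact pow_le_pow_right₀ hbi (by omega)
      have h4 : R * M ≤ 1 + 2 * M + R * M := by nlinarith
      calc _ = B * l⁻¹ ^ i * ((1 + 2 * M + R * M) ^ n * b⁻¹ ^ (k ^ 2) * (b ^ n) ^ (k + 1)) *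
            (ε * (R * M)) := by
            rw [pow_succ, pow_succ (b ^ n)]
            field_simp
        _ ≤ B * l⁻¹ ^ i * ((1 + 2 * M + R * M) ^ n * (b⁻¹ ^ ((k + 1) ^ 2) * b ^ (k + 1)) *
            (b ^ n) ^ (k + 1)) * (1 * (1 + 2 * M + R * M)) := by gcongr
        _ = _ := by
            rw [pow_succ b n, mul_pow, pow_succ _ n]
            ring

end IsKernel

/-- If a distribution is bounded by `A s^α` on the rescalings by `s` of one test function with
nonzero integral, then it is bounded by a multiple of `A l^α` on all test functions at scale `l`,
normalized in `C^r`. The constants depend on the given test function and on `α` only. -/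
theorem exists_bound_of_rescale_bound {f : E d → 𝕜} (hf : ContDiff ℝ ∞ f)
    (hf' : HasCompactSupport f) (hint : ∫ x, f x ≠ 0) (α : ℝ) :
    ∃ r : ℕ, ∃ C : ℝ, ∃ ε : ℝ, 0 ≤ C ∧ 0 < ε ∧ ε ≤ 1 ∧
      ∀ (W : Set (E d)) (T : (E d → 𝕜) → 𝕜), IsDistrOn T W → ∀ (q : E d) (l A : ℝ), 0 < l →
      closedBall q (3 * l) ⊆ W → 0 ≤ A →
      (∀ y ∈ closedBall q (2 * l), ∀ s ∈ Ioc 0 (ε * l), ‖T (rescale f y s)‖ ≤ A * s ^ α) →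
      ∀ g, ContDiff ℝ ∞ g → tsupport g ⊆ closedBall q l → ∀ B, DerivBound r l B g →
        ‖T g‖ ≤ C * A * B * l ^ (α + d) := by
  obtain ⟨R, M, h⟩ := exists_isKernel hf hf' hint
  set I := ∫ x, f x with hI
  set φ := I⁻¹ • f with hφ
  have hM := h.nonneg
  have hR := h.pos
  set C₀ := 1 + 2 * M + R * M with hC₀
  have hC1 : 1 ≤ C₀ := by rw [hC₀]; nlinarith
  have hC0 : 0 < C₀ := by linarith
  -- With this ratio, the growth of the residuals by `C₀` per step is compensated by one power
  -- of the length.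
  set b := 1 / (2 * C₀) with hbdef
  have hb : 0 < b := by positivity
  have hC₀b : C₀ * b = 1 / 2 := by rw [hbdef]; field_simp
  have hb2 : b ≤ 1 / 2 := by nlinarith
  set r := ⌈1 - α⌉₊ with hr
  have hrα : 1 ≤ α + r := by linarith [Nat.le_ceil (1 - α)]
  obtain ⟨ε, hε, hε1, hεR⟩ : ∃ ε : ℝ, 0 < ε ∧ ε ≤ 1 ∧ ε * R ≤ 1 / 2 := by
    refine ⟨1 / (2 * R), by positivity, ?_, by field_simp; rfl⟩
    rw [div_le_one (by positivity)]
    linarith [h.one_le]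
  set v := (volume : Measure (E d)).real (ball 0 1) with hv
  refine ⟨r, 2 * (‖I⁻¹‖ * ε ^ α * b⁻¹ ^ (r ^ 2) * (2 ^ d * v)), ε, by positivity, hε, hε1,
    fun W T hT q l A hl hW hA hTf g hg hgq B hB => ?_⟩
  have hB0 := hB.nonneg
  set s : ℕ → ℝ := fun n => ε * l * b ^ n with hs
  have hs0 : ∀ n, 0 < s n := fun n => by positivity
  have hbn : ∀ n, b ^ n ≤ 1 := fun n => pow_le_one₀ hb.le (by linarith)
  have hsl : ∀ n, s n ≤ ε * l := fun n => mul_le_of_le_one_right (by positivity) (hbn n)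
  set G := residual φ s g with hG
  have hGs : ∀ n, ContDiff ℝ ∞ (G n) ∧ tsupport (G n) ⊆ closedBall q (2 * l) := fun n => by
    obtain ⟨h1, h2⟩ := h.residual_smooth_and_support hl hb hb2 hε hεR hg hgq n
    refine ⟨h1, h2.trans (closedBall_subset_closedBall ?_)⟩
    nlinarith [pow_pos hb n]
  have hball : closedBall q (2 * l) ⊆ W :=
    (closedBall_subset_closedBall (by linarith)).trans hW
  have hGt : ∀ n, IsTest W (G n) := fun n =>
    .of_subset_compact (hGs n).1 (isCompact_closedBall _ _) (hGs n).2 hball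
  have hsm : ∀ n, IsTest W (smear φ (s n) (G n)) := fun n => by
    have : smear φ (s n) (G n) = G n - G (n + 1) := by
      simp only [hG, residual, sub_sub_cancel]
    rw [this]
    exact (hGt n).sub (hGt (n + 1))
  have hstep : ∀ n, T (G (n + 1)) = T (G n) - T (smear φ (s n) (G n)) := fun n =>
    hT.map_sub (hGt n) (hsm n)
  have hsum : ∀ n, T g = ∑ k ∈ Finset.range n, T (smear φ (s k) (G k)) + T (G n) := by
    intro n
    induction n with
    | zero => simp [hG, residual]
    | succ n ih => rw [Finset.sum_range_succ, hstep, ih]; ring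
  set Q := A * ‖I⁻¹‖ * (ε * l) ^ α * (B * b⁻¹ ^ (r ^ 2) * ((2 * l) ^ d * v)) with hQ
  have hQ0 : 0 ≤ Q := by positivity
  have hterm : ∀ n, ‖T (smear φ (s n) (G n))‖ ≤ Q * (1 / 2) ^ n := by
    intro n
    have h1 : ‖T (smear φ (s n) (G n))‖ ≤ (‖I⁻¹‖ * (A * s n ^ α)) * ∫ y, ‖G n y‖ := by
      refine h.norm_apply_smear_le hT (hGs n).1 (isCompact_closedBall q (2 * l))
        (isCompact_closedBall q (3 * l)) hW (hGs n).2 (hs0 n) (fun y hy => ?_) (by positivity)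
        fun y hy => ?_
      · refine closedBall_subset_closedBall' ?_
        have h1 : dist y q ≤ 2 * l := hy
        have h2 : s n * R ≤ 1 / 2 * l := by
          calc s n * R ≤ ε * l * R := by gcongr; exact hsl n
            _ = ε * R * l := by ring
            _ ≤ _ := by gcongr
        linarith
      · have h1 : rescale φ y (s n) = I⁻¹ • rescale f y (s n) := by
          ext x; simp only [rescale, hφ, Pi.smul_apply]; rw [smul_comm]
        have hRf : ∀ x, f x ≠ 0 → ‖x‖ ≤ R := fun x hx => 
          h.norm_le x (mul_ne_zero (inv_ne_zero hint) hx)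
        have h2 : IsTest W (rescale f y (s n)) := by
          refine isTest_rescale hf hRf (hs0 n) (Subset.trans ?_ hW)
          refine closedBall_subset_closedBall' ?_
          have h1 : dist y q ≤ 2 * l := hy
          have h2 : s n * R ≤ 1 / 2 * l := by
            calc s n * R ≤ ε * l * R := by gcongr; exact hsl n
              _ = ε * R * l := by ring
              _ ≤ _ := by gcongr
          linarith
        rw [h1, hT.map_smul _ _ h2, norm_mul]
        gcongr
        exact hTf y hy _ ⟨hs0 n, hsl n⟩
    have h2 : ∫ y, ‖G n y‖ ≤ B * (C₀ ^ n * b⁻¹ ^ (r ^ 2) * (b ^ n) ^ r) * ((2 * l) ^ d * v) := by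
      have h3 : ∀ y, ‖G n y‖ ≤ B * (C₀ ^ n * b⁻¹ ^ (r ^ 2) * (b ^ n) ^ r) := fun y => by
        simpa using h.derivBound_residual hl hb hb2 hε hε1 hεR hg hgq hB r n (i := 0)
          (by omega) y
      have h4 : ∫ y, ‖G n y‖ = ∫ y in closedBall q (2 * l), ‖G n y‖ := by
        refine (setIntegral_eq_integral_of_forall_compl_eq_zero fun y hy => ?_).symm
        rw [norm_eq_zero]
        exact image_eq_zero_of_notMem_tsupport fun hy' => hy ((hGs n).2 hy')
      rw [h4]
      have h5 := norm_setIntegral_le_of_norm_le_const (μ := (volume : Measure (E d)))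
        (isCompact_closedBall q (2 * l)).measure_lt_top (f := fun y => ‖G n y‖)
        (fun y _ => (norm_norm _).le.trans (h3 y))
      refine ((le_abs_self _).trans h5).trans (le_of_eq ?_)
      rw [Measure.real, Measure.addHaar_closedBall _ _ (by positivity), ENNReal.toReal_mul,
        ENNReal.toReal_ofReal (by positivity), finrank_euclideanSpace_fin]
      rfl
    have h3 : (C₀ ^ n * (b ^ n) ^ r) * (b ^ n) ^ α ≤ (1 / 2) ^ n := by
      have hp : 0 < b ^ n := by positivity
      rw [mul_assoc, ← Real.rpow_natCast (b ^ n) r, ← Real.rpow_add hp, ← hC₀b, mul_pow]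
      gcongr
      calc (b ^ n) ^ ((r : ℝ) + α) ≤ (b ^ n) ^ (1 : ℝ) :=
            Real.rpow_le_rpow_of_exponent_ge hp (hbn n) (by linarith)
        _ = b ^ n := Real.rpow_one _
    have h4 : s n ^ α = (ε * l) ^ α * (b ^ n) ^ α :=
      Real.mul_rpow (by positivity) (by positivity)
    calc _ ≤ (‖I⁻¹‖ * (A * ((ε * l) ^ α * (b ^ n) ^ α))) *
          (B * (C₀ ^ n * b⁻¹ ^ (r ^ 2) * (b ^ n) ^ r) * ((2 * l) ^ d * v)) := by
          rw [← h4]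
          exact h1.trans (by gcongr)
      _ = Q * ((C₀ ^ n * (b ^ n) ^ r) * (b ^ n) ^ α) := by rw [hQ]; ring
      _ ≤ _ := by gcongr
  have hrem : Tendsto (fun n => T (G n)) atTop (𝓝 0) := by
    obtain ⟨m, C, hC, hm⟩ := hT.bound _ (isCompact_closedBall q (2 * l)) hball
    have hgc : HasCompactSupport g :=
      (isCompact_closedBall _ _).of_isClosed_subset (isClosed_tsupport _) hgq
    obtain ⟨B', hB'⟩ := exists_derivBound hg hgc (m + 1) hl
    have hB'0 := hB'.nonneg
    set l' := min l 1 with hl'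
    have hl'0 : 0 < l' := lt_min hl one_pos
    refine squeeze_zero_norm (a := fun n => C * (l'⁻¹ ^ m * (B' * b⁻¹)) * (1 / 2) ^ n)
      (fun n => ?_) ?_
    · have h1 : DerivBound m l (B' * b⁻¹ * (1 / 2) ^ n) (G n) := by
        intro i hi x
        have := h.derivBound_residual hl hb hb2 hε hε1 hεR hg hgq hB' 1 n (i := i) (by omega) x
        refine this.trans (le_of_eq ?_)
        rw [← hC₀b, ← hC₀, mul_pow]; simp; ring
      have h2 := (h1.scale_mono hl'0 (min_le_left _ _)).mul_scale hl'0
        ((one_le_inv₀ hl'0).2 (min_le_right l 1))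
      rw [inv_mul_cancel₀ hl'0.ne'] at h2
      refine (hm _ (hGs n).1 (hGs n).2 _ h2).trans (le_of_eq (by ring))
    · simpa using (tendsto_pow_atTop_nhds_zero_of_lt_one (r := (1 / 2 : ℝ)) (by norm_num)
        (by norm_num)).const_mul (C * (l'⁻¹ ^ m * (B' * b⁻¹)))
  have hfin : ∀ n, ‖T g‖ ≤ Q * 2 + ‖T (G n)‖ := fun n => by
    rw [hsum n]
    refine (norm_add_le _ _).trans (add_le_add ?_ le_rfl)
    refine (norm_sum_le_of_le _ fun k _ => hterm k).trans ?_
    rw [← Finset.mul_sum]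
    gcongr
    exact sum_geometric_two_le n
  have hlim : ‖T g‖ ≤ Q * 2 := by
    have := (hrem.norm.const_add (Q * 2))
    rw [norm_zero, add_zero] at this
    exact ge_of_tendsto' this hfin
  refine hlim.trans (le_of_eq ?_)
  rw [hQ, Real.mul_rpow hε.le hl.le, Real.rpow_add hl, Real.rpow_natCast]
  ring

end Residual

end GermReconstruction

end

noncomputable section

namespace GermReconstruction

open Set Filter Topology MeasureTheory Metric

/-! ### Smooth partitions of unity over lattices -/

section Lattice

variable {𝕜 : Type*} [RCLike 𝕜] {d : ℕ}

/-- A smooth function on the line, supported in `[-1, 1]`, whose integer translates sum to one. -/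
def lineBump (t : ℝ) : ℝ :=
  Real.smoothTransition (t + 1) - Real.smoothTransition t

lemma lineBump_eq_zero {t : ℝ} (ht : 1 ≤ |t|) : lineBump t = 0 := by
  rcases le_abs.1 ht with h | h
  · rw [lineBump, Real.smoothTransition.one_of_one_le (by linarith),
      Real.smoothTransition.one_of_one_le h, sub_self]
  · rw [lineBump, Real.smoothTransition.zero_of_nonpos (by linarith),
      Real.smoothTransition.zero_of_nonpos (by linarith), sub_self]

lemma contDiff_lineBump : ContDiff ℝ ∞ lineBump :=
  (Real.smoothTransition.contDiff.comp (contDiff_id.add contDiff_const)).sub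
    Real.smoothTransition.contDiff

lemma sum_lineBump {t : ℝ} {a b : ℤ} (ha : a ≤ ⌊t⌋) (hb : ⌊t⌋ + 1 ≤ b) :
    ∑ k ∈ Finset.Icc a b, lineBump (t - k) = 1 := by
  have h0 : (⌊t⌋ : ℝ) ≤ t := Int.floor_le t
  have h1 : t < ⌊t⌋ + 1 := Int.lt_floor_add_one t
  have hsub : ({⌊t⌋, ⌊t⌋ + 1} : Finset ℤ) ⊆ Finset.Icc a b := by
    intro k hk
    simp only [Finset.mem_insert, Finset.mem_singleton] at hk
    rw [Finset.mem_Icc]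
    omega
  rw [← Finset.sum_subset hsub, Finset.sum_pair (by omega)]
  · simp only [lineBump]
    rw [Real.smoothTransition.one_of_one_le (x := t - ⌊t⌋ + 1) (by linarith),
      Real.smoothTransition.zero_of_nonpos (x := t - (⌊t⌋ + 1 : ℤ)) (by push_cast; linarith)]
    push_cast
    rw [show t - (⌊t⌋ + 1) + 1 = t - (⌊t⌋ : ℝ) by ring]
    ring
  · intro k _ hk
    simp only [Finset.mem_insert, Finset.mem_singleton, not_or] at hk
    refine lineBump_eq_zero (le_abs.2 ?_)
    rcases lt_or_gt_of_ne hk.1 with h | h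
    · left
      have : (k : ℝ) + 1 ≤ ⌊t⌋ := by exact_mod_cast h
      linarith
    · right
      have : (⌊t⌋ : ℝ) + 1 + 1 ≤ k := by
        have : ⌊t⌋ + 1 + 1 ≤ k := by omega
        exact_mod_cast this
      linarith

/-- The tensor power of `lineBump`; its translates by the integer lattice sum to one. -/
def latticeBump (x : E d) : ℝ := ∏ i, lineBump (x i)

lemma contDiff_latticeBump : ContDiff ℝ ∞ (latticeBump (d := d)) :=
  contDiff_prod fun i _ => contDiff_lineBump.comp (contDiff_piLp_apply (p := 2) (i := i))

lemma norm_le_of_abs_le {x : E d} {a : ℝ} (ha : 0 ≤ a) (h : ∀ i, |x i| ≤ a) :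
    ‖x‖ ≤ (d + 1) * a := by
  rw [EuclideanSpace.norm_eq]
  refine Real.sqrt_le_iff.2 ⟨by positivity, ?_⟩
  calc ∑ i, ‖x i‖ ^ 2 ≤ ∑ _i : Fin d, a ^ 2 := by
        gcongr with i
        exact h i
    _ = d * a ^ 2 := by simp
    _ ≤ ((d + 1) * a) ^ 2 := by
        rw [mul_pow]
        gcongr
        nlinarith [(Nat.cast_nonneg d : (0 : ℝ) ≤ d)]

lemma abs_lt_of_latticeBump_ne_zero {x : E d} (h : latticeBump x ≠ 0) (i : Fin d) : |x i| < 1 := by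
  by_contra hi
  exact h (Finset.prod_eq_zero (Finset.mem_univ i) (lineBump_eq_zero (not_lt.1 hi)))

lemma norm_le_of_latticeBump_ne_zero {x : E d} (h : latticeBump x ≠ 0) : ‖x‖ ≤ d + 1 := by
  simpa using norm_le_of_abs_le zero_le_one fun i => (abs_lt_of_latticeBump_ne_zero h i).le

lemma hasCompactSupport_latticeBump : HasCompactSupport (latticeBump (d := d)) :=
  HasCompactSupport.of_support_subset_isCompact (isCompact_closedBall 0 ((d : ℝ) + 1)) fun x hx => by
    simpa using norm_le_of_latticeBump_ne_zero hx

/-- The points of the lattice `ε ℤ^d`. -/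
def node (ε : ℝ) (k : Fin d → ℤ) : E d := WithLp.toLp 2 fun i => ε * k i

/-- The function of the partition of unity that belongs to a lattice point. -/
def cell (ε : ℝ) (k : Fin d → ℤ) (y : E d) : ℝ := latticeBump (ε⁻¹ • (y - node ε k))

/-- A finite set of lattice points, large enough to contain those that matter near
`closedBall x l`. -/
def box (ε : ℝ) (x : E d) (l : ℝ) : Finset (Fin d → ℤ) :=
  Fintype.piFinset fun i => Finset.Icc ⌈(x i - 2 * l) / ε⌉ ⌊(x i + 2 * l) / ε⌋

variable {ε l : ℝ} {x y : E d} {k : Fin d → ℤ}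

lemma cell_eq_prod (hε : 0 < ε) (k : Fin d → ℤ) (y : E d) :
    cell ε k y = ∏ i, lineBump (y i / ε - k i) := by
  unfold cell latticeBump
  refine Finset.prod_congr rfl fun i _ => ?_
  congr 1
  simp only [node, PiLp.smul_apply, PiLp.sub_apply, smul_eq_mul]
  field_simp

lemma contDiff_cell (ε : ℝ) (k : Fin d → ℤ) : ContDiff ℝ ∞ (cell ε k) :=
  contDiff_latticeBump.comp (by fun_prop)

lemma dist_node_le_of_cell_ne_zero (hε : 0 < ε) (h : cell ε k y ≠ 0) :
    dist y (node ε k) ≤ (d + 1) * ε := by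
  have := norm_le_of_latticeBump_ne_zero h
  rwa [norm_smul, Real.norm_of_nonneg (by positivity), inv_mul_le_iff₀ hε, mul_comm,
    ← dist_eq_norm] at this

lemma abs_sub_apply_le_dist (x y : E d) (i : Fin d) : |y i - x i| ≤ dist y x := by
  rw [dist_eq_norm]
  exact PiLp.norm_apply_le (y - x) i

lemma mem_box_of_cell_ne_zero (hε : 0 < ε) (hεl : ε ≤ l) (hy : dist y x ≤ l) (h : cell ε k y ≠ 0) :
    k ∈ box ε x l := by
  rw [box, Fintype.mem_piFinset]
  intro i
  have h1 : |y i / ε - k i| < 1 := by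
    have := abs_lt_of_latticeBump_ne_zero h i
    simp only [node, PiLp.smul_apply, PiLp.sub_apply, smul_eq_mul] at this
    convert this using 2
    field_simp
  have h2 := abs_le.1 ((abs_sub_apply_le_dist x y i).trans hy)
  obtain ⟨h3, h4⟩ := abs_lt.1 h1
  rw [Finset.mem_Icc, Int.ceil_le, Int.le_floor, div_le_iff₀ hε, le_div_iff₀ hε]
  have h5 : y i = y i / ε * ε := by field_simp
  constructor <;> nlinarith

lemma sum_cell (hε : 0 < ε) (hεl : ε ≤ l) (hy : dist y x ≤ l) :
    ∑ k ∈ box ε x l, cell ε k y = 1 := by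
  simp_rw [cell_eq_prod hε]
  rw [box, ← Finset.prod_univ_sum (fun i => Finset.Icc ⌈(x i - 2 * l) / ε⌉ ⌊(x i + 2 * l) / ε⌋)
    (fun i (k : ℤ) => lineBump (y i / ε - k))]
  refine Finset.prod_eq_one fun i _ => sum_lineBump ?_ ?_
  all_goals have h2 := abs_le.1 ((abs_sub_apply_le_dist x y i).trans hy)
  all_goals have h5 : y i = y i / ε * ε := by field_simp
  · rw [Int.ceil_le, div_le_iff₀ hε]
    have := Int.lt_floor_add_one (y i / ε)
    nlinarith
  · rw [Int.le_floor, le_div_iff₀ hε]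
    push_cast
    have := Int.floor_le (y i / ε)
    nlinarith

lemma card_box_le (hε : 0 < ε) (hεl : ε ≤ l) (x : E d) :
    ((box ε x l).card : ℝ) ≤ (5 * (l / ε)) ^ d := by
  rw [box, Fintype.card_piFinset]
  push_cast
  calc _ ≤ ∏ _i : Fin d, 5 * (l / ε) := by
        gcongr with i
        rw [Int.card_Icc]
        have h1 : 1 ≤ l / ε := (one_le_div hε).2 hεl
        have h3 : (x i - 2 * l) / ε ≤ ⌈(x i - 2 * l) / ε⌉ := Int.le_ceil _
        have h4 : (⌊(x i + 2 * l) / ε⌋ : ℝ) ≤ (x i + 2 * l) / ε := Int.floor_le _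
        have h5 : (x i + 2 * l) / ε - (x i - 2 * l) / ε = 4 * (l / ε) := by ring
        have h6 : (((⌊(x i + 2 * l) / ε⌋ + 1 - ⌈(x i - 2 * l) / ε⌉).toNat : ℤ) : ℝ) ≤
            5 * (l / ε) := by
          rw [Int.toNat_eq_max]
          push_cast
          refine max_le ?_ (by positivity)
          linarith
        exact_mod_cast h6
    _ = _ := by simp

lemma exists_derivBound_cell (d r : ℕ) :
    ∃ A : ℝ, 0 ≤ A ∧ ∀ ε : ℝ, 0 < ε → ∀ k : Fin d → ℤ, DerivBound r ε A (cell ε k) := by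
  obtain ⟨A, hA⟩ := exists_derivBound (contDiff_latticeBump (d := d))
    hasCompactSupport_latticeBump r one_pos
  refine ⟨A, hA.nonneg, fun ε hε k => ?_⟩
  have := hA.comp_smul_sub contDiff_latticeBump hε one_pos (node ε k)
  rwa [mul_one] at this

lemma tsupport_cell_subset (hε : 0 < ε) (k : Fin d → ℤ) :
    tsupport (cell ε k) ⊆ closedBall (node ε k) ((d + 1) * ε) :=
  closure_minimal (fun _ hy => dist_node_le_of_cell_ne_zero hε hy) isClosed_closedBall

/-- The product of `h` with a function of the partition of unity. -/
def cut (ε : ℝ) (k : Fin d → ℤ) (h : E d → 𝕜) : E d → 𝕜 := fun y => cell ε k y • h y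

variable {W : Set (E d)} {h : E d → 𝕜}

lemma IsTest.cut (hh : IsTest W h) (ε : ℝ) (k : Fin d → ℤ) :
    IsTest W (GermReconstruction.cut ε k h) :=
  hh.real_smul (contDiff_cell ε k)

lemma tsupport_cut_subset (ε : ℝ) (k : Fin d → ℤ) (h : E d → 𝕜) :
    tsupport (cut ε k h) ⊆ tsupport (cell ε k) ∩ tsupport h :=
  tsupport_real_smul_subset _ _

lemma exists_of_cut_ne_zero (hk : cut ε k h ≠ 0) : ∃ y, cell ε k y ≠ 0 ∧ h y ≠ 0 := by
  obtain ⟨y, hy⟩ := Function.ne_iff.1 hk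
  exact ⟨y, (smul_ne_zero_iff.1 hy).1, (smul_ne_zero_iff.1 hy).2⟩

lemma eq_sum_cut (hε : 0 < ε) (hεl : ε ≤ l) (hx : tsupport h ⊆ closedBall x l) :
    h = ∑ k ∈ box ε x l, cut ε k h := by
  ext y
  simp only [Finset.sum_apply, cut]
  rw [← Finset.sum_smul]
  by_cases hy : h y = 0
  · simp [hy]
  · rw [sum_cell hε hεl (hx (subset_tsupport _ hy)), one_smul]

lemma DerivBound.cut {r : ℕ} {A B : ℝ} (hh : DerivBound r l B h) (hh' : ContDiff ℝ ∞ h)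
    (hl : 0 < l) (hA : DerivBound r l A (cell ε k)) :
    DerivBound r l (2 ^ r * A * B) (GermReconstruction.cut ε k h) :=
  hA.smul hh (contDiff_cell ε k) hh' hl

/-! ### Reconstruction of a germ on an open set of `ℝ^d` -/

/-- The approximation of the reconstruction of the germ `G` at the length `ε`: each piece of the
test function is evaluated by the distribution of the germ at the nearest lattice point. -/
def latticeSum (G : E d → (E d → 𝕜) → 𝕜) (ε : ℝ) (h : E d → 𝕜) : 𝕜 :=
  ∑ᶠ k, G (node ε k) (cut ε k h)

/-- Coherence of a germ `G` on `W` at comparable distance and scale, for all test functions: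
`G p - G q` is of size `l^γ` on `C^r`-normalized test functions at scale `l` near `q`, if
`dist p q ≤ l`. The power `l^d` is due to the normalization of the test functions. -/
def StronglyCoherent (γ : ℝ) (W : Set (E d)) (G : E d → (E d → 𝕜) → 𝕜) : Prop :=
  ∀ K : Set (E d), IsCompact K → K ⊆ W → ∃ r : ℕ, ∃ C : ℝ, ∃ δ : ℝ, 0 ≤ C ∧ 0 < δ ∧
    ∀ q ∈ K, ∀ l ∈ Ioc 0 δ, ∀ p, dist p q ≤ l → ∀ g, ContDiff ℝ ∞ g →
      tsupport g ⊆ closedBall q l → ∀ B, DerivBound r l B g →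
        ‖G p g - G q g‖ ≤ C * B * l ^ (γ + d)

/-- `R` is a reconstruction of the germ `G` on `W`, uniformly over all `C^r`-normalized test
functions at scale `l`. -/
def StronglyReconstructs (γ : ℝ) (W : Set (E d)) (G : E d → (E d → 𝕜) → 𝕜)
    (R : (E d → 𝕜) → 𝕜) : Prop :=
  ∀ K : Set (E d), IsCompact K → K ⊆ W → ∃ r : ℕ, ∃ C : ℝ, ∃ δ : ℝ, 0 ≤ C ∧ 0 < δ ∧
    ∀ q ∈ K, ∀ l ∈ Ioc 0 δ, ∀ g, ContDiff ℝ ∞ g →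
      tsupport g ⊆ closedBall q l → ∀ B, DerivBound r l B g →
        ‖R g - G q g‖ ≤ C * B * l ^ (γ + d)

variable {G : E d → (E d → 𝕜) → 𝕜}

lemma latticeSum_eq_sum (hG : ∀ p, IsDistrOn (G p) W) (hε : 0 < ε) (hεl : ε ≤ l)
    (hx : tsupport h ⊆ closedBall x l) :
    latticeSum G ε h = ∑ k ∈ box ε x l, G (node ε k) (cut ε k h) := by
  refine finsum_eq_sum_of_support_subset _ fun k hk => ?_
  have hk' : cut ε k h ≠ 0 := fun h0 => hk (by simp only [h0, (hG _).map_zero])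
  obtain ⟨y, hy, hhy⟩ := exists_of_cut_ne_zero hk'
  exact mem_box_of_cell_ne_zero hε hεl (hx (subset_tsupport _ hhy)) hy

/-- Halving the mesh of the lattice. There are `O((l / ε)^d)` pairs of overlapping pieces of the two
partitions of unity, and each contributes `O(ε^(γ + d))` by coherence. -/
lemma exists_norm_latticeSum_half_sub_le (d r : ℕ) (γ : ℝ) :
    ∃ Q : ℝ, 0 ≤ Q ∧ ∀ (W S : Set (E d)) (G : E d → (E d → 𝕜) → 𝕜) (C δ : ℝ),
      (∀ p, IsDistrOn (G p) W) → 0 ≤ C →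
      (∀ q ∈ S, ∀ l ∈ Ioc 0 δ, ∀ p, dist p q ≤ l → ∀ g, ContDiff ℝ ∞ g →
        tsupport g ⊆ closedBall q l → ∀ B, DerivBound r l B g →
          ‖G p g - G q g‖ ≤ C * B * l ^ (γ + d)) →
      ∀ (h : E d → 𝕜) (x : E d) (l ε B : ℝ), IsTest W h → tsupport h ⊆ closedBall x l →
        0 < ε → ε ≤ l → 2 * (d + 1) * ε ≤ δ → (∀ k, cut ε k h ≠ 0 → node ε k ∈ S) →
        DerivBound r l B h →
          ‖latticeSum G (ε / 2) h - latticeSum G ε h‖ ≤ Q * C * B * l ^ d * ε ^ γ := by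
  obtain ⟨A, hA0, hA⟩ := exists_derivBound_cell d r
  set D : ℝ := d + 1 with hD
  have hD1 : 1 ≤ D := by rw [hD]; linarith [(Nat.cast_nonneg d : (0 : ℝ) ≤ d)]
  have hD0 : 0 < D := by linarith
  refine ⟨5 ^ d * (10 * D) ^ d * ((2 * D) ^ r * (2 ^ r * A * (2 ^ r * (2 ^ r * A)))) *
    (2 * D) ^ (γ + d), by positivity, ?_⟩
  intro W S G C δ hG hC hS h x l ε B hh hx hε hεl hδ hnode hB
  have hl : 0 < l := hε.trans_le hεl
  have hε2 : 0 < ε / 2 := by positivity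
  have hB0 := hB.nonneg
  set u : (Fin d → ℤ) → (Fin d → ℤ) → E d → 𝕜 := fun k j => cut ε k (cut (ε / 2) j h) with hu
  have hut : ∀ k j, IsTest W (u k j) := fun k j => (hh.cut _ j).cut _ k
  have hucomm : ∀ k j, u k j = cut (ε / 2) j (cut ε k h) := fun k j => by
    ext y; simp only [hu, cut]; rw [smul_comm]
  have hcutx : ∀ (ε' : ℝ) (j : Fin d → ℤ), tsupport (cut ε' j h) ⊆ closedBall x l := fun ε' j =>
    ((tsupport_cut_subset ε' j h).trans inter_subset_right).trans hx
  have e1 : latticeSum G (ε / 2) h =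
      ∑ k ∈ box ε x l, ∑ j ∈ box (ε / 2) x l, G (node (ε / 2) j) (u k j) := by
    rw [latticeSum_eq_sum hG hε2 (by linarith) hx, Finset.sum_comm]
    refine Finset.sum_congr rfl fun j _ => ?_
    rw [← (hG _).map_sum _ fun k _ => hut k j, ← eq_sum_cut hε hεl (hcutx _ j)]
  have e2 : latticeSum G ε h =
      ∑ k ∈ box ε x l, ∑ j ∈ box (ε / 2) x l, G (node ε k) (u k j) := by
    rw [latticeSum_eq_sum hG hε hεl hx]
    refine Finset.sum_congr rfl fun k _ => ?_
    rw [← (hG _).map_sum _ fun j _ => hut k j]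
    simp_rw [hucomm]
    rw [← eq_sum_cut hε2 (by linarith) (hcutx _ k)]
  set P := C * ((2 * D) ^ r * (2 ^ r * A * (2 ^ r * (2 ^ r * A) * B))) * (2 * D * ε) ^ (γ + d)
    with hP
  have hP0 : 0 ≤ P := by positivity
  have hterm : ∀ k j, ‖G (node (ε / 2) j) (u k j) - G (node ε k) (u k j)‖ ≤
      if j ∈ box (ε / 2) (node ε k) (D * ε) then P else 0 := by
    intro k j
    by_cases hukj : u k j = 0
    · rw [hukj, (hG _).map_zero, (hG _).map_zero, sub_self, norm_zero]
      split_ifs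
      · exact hP0
      · exact le_rfl
    obtain ⟨y, hyk, hy⟩ := exists_of_cut_ne_zero hukj
    obtain ⟨hyj, hhy⟩ := smul_ne_zero_iff.1 hy
    have hdk : dist y (node ε k) ≤ D * ε := dist_node_le_of_cell_ne_zero hε hyk
    have hdj : dist y (node (ε / 2) j) ≤ D * (ε / 2) := dist_node_le_of_cell_ne_zero hε2 hyj
    have hεD : ε ≤ D * ε := le_mul_of_one_le_left hε.le hD1
    rw [if_pos (mem_box_of_cell_ne_zero hε2 (by linarith) hdk hyj)]
    refine hS _ (hnode k ?_) (2 * D * ε) ⟨by positivity, hδ⟩ _ ?_ _ (hut k j).contDiff ?_ _ ?_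
    · intro h0
      exact hukj (by rw [hucomm, h0]; ext z; simp [cut])
    · calc _ ≤ dist y (node (ε / 2) j) + dist y (node ε k) := dist_triangle_left _ _ _
        _ ≤ D * (ε / 2) + D * ε := add_le_add hdj hdk
        _ ≤ _ := by nlinarith
    · refine ((tsupport_cut_subset _ _ _).trans inter_subset_left).trans
        ((tsupport_cell_subset hε k).trans (closedBall_subset_closedBall ?_))
      rw [← hD]; nlinarith
    · refine DerivBound.mul_scale ?_ hε (by linarith)
      have h1 : DerivBound r ε (2 ^ r * A) (cell (ε / 2) j) := by
        simpa [mul_div_cancel₀] using (hA (ε / 2) hε2 j).mul_scale hε2 one_le_two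
      exact ((hB.scale_mono hε hεl).cut hh.contDiff hε h1).cut (hh.cut _ _).contDiff hε (hA ε hε k)
  rw [e1, e2, ← Finset.sum_sub_distrib]
  simp_rw [← Finset.sum_sub_distrib]
  have hinner : ∀ k, ‖∑ j ∈ box (ε / 2) x l, (G (node (ε / 2) j) (u k j) - G (node ε k) (u k j))‖ ≤
      (10 * D) ^ d * P := by
    intro k
    refine (norm_sum_le_of_le _ fun j _ => hterm k j).trans ?_
    rw [← Finset.sum_filter, Finset.sum_const, nsmul_eq_mul]
    gcongr
    have h1 : ((box (ε / 2) (node ε k) (D * ε)).card : ℝ) ≤ (10 * D) ^ d := by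
      refine (card_box_le hε2 (by nlinarith) _).trans (le_of_eq ?_)
      congr 1
      field_simp
      ring
    refine le_trans ?_ h1
    exact_mod_cast Finset.card_le_card fun j hj => (Finset.mem_filter.1 hj).2
  calc _ ≤ ∑ _k ∈ box ε x l, (10 * D) ^ d * P := norm_sum_le_of_le _ fun k _ => hinner k
    _ ≤ (5 * (l / ε)) ^ d * ((10 * D) ^ d * P) := by
        rw [Finset.sum_const, nsmul_eq_mul]
        gcongr
        exact card_box_le hε hεl x
    _ = _ := by
        rw [hP, Real.mul_rpow (by positivity) hε.le, Real.rpow_add hε, Real.rpow_natCast, mul_pow,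
          div_pow]
        field_simp

/-- The approximation whose mesh is comparable to the scale of the test function. -/
lemma exists_norm_latticeSum_sub_apply_le (d r : ℕ) (γ : ℝ) :
    ∃ Q : ℝ, 0 ≤ Q ∧ ∀ (W S : Set (E d)) (G : E d → (E d → 𝕜) → 𝕜) (C δ : ℝ),
      (∀ p, IsDistrOn (G p) W) → 0 ≤ C →
      (∀ q ∈ S, ∀ l ∈ Ioc 0 δ, ∀ p, dist p q ≤ l → ∀ g, ContDiff ℝ ∞ g →
        tsupport g ⊆ closedBall q l → ∀ B, DerivBound r l B g →
          ‖G p g - G q g‖ ≤ C * B * l ^ (γ + d)) →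
      ∀ (h : E d → 𝕜) (q : E d) (l ε B : ℝ), IsTest W h → tsupport h ⊆ closedBall q l →
        q ∈ S → 0 < ε → ε ≤ l → l ≤ 2 * ε → 2 * (d + 1) * l ≤ δ → DerivBound r l B h →
          ‖latticeSum G ε h - G q h‖ ≤ Q * C * B * l ^ (γ + d) := by
  obtain ⟨A, hA0, hA⟩ := exists_derivBound_cell d r
  set D : ℝ := d + 1 with hD
  have hD1 : 1 ≤ D := by rw [hD]; linarith [(Nat.cast_nonneg d : (0 : ℝ) ≤ d)]
  have hD0 : 0 < D := by linarith
  refine ⟨10 ^ d * ((2 * D) ^ r * (2 ^ r * (2 ^ r * A))) * (2 * D) ^ (γ + d), by positivity, ?_⟩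
  intro W S G C δ hG hC hS h q l ε B hh hq hqS hε hεl hlε hδ hB
  have hl : 0 < l := hε.trans_le hεl
  have hB0 := hB.nonneg
  have hct : ∀ k, IsTest W (cut ε k h) := fun k => hh.cut ε k
  have e1 : G q h = ∑ k ∈ box ε q l, G q (cut ε k h) := by
    rw [← (hG q).map_sum _ fun k _ => hct k, ← eq_sum_cut hε hεl hq]
  set P := C * ((2 * D) ^ r * (2 ^ r * (2 ^ r * A) * B)) * (2 * D * l) ^ (γ + d) with hP
  have hP0 : 0 ≤ P := by positivity
  have hterm : ∀ k, ‖G (node ε k) (cut ε k h) - G q (cut ε k h)‖ ≤ P := by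
    intro k
    by_cases hk : cut ε k h = 0
    · rw [hk, (hG _).map_zero, (hG _).map_zero, sub_self, norm_zero]
      exact hP0
    obtain ⟨y, hyk, hy⟩ := exists_of_cut_ne_zero hk
    have hdk : dist y (node ε k) ≤ D * ε := dist_node_le_of_cell_ne_zero hε hyk
    have hdq : dist y q ≤ l := hq (subset_tsupport _ hy)
    refine hS q hqS (2 * D * l) ⟨by positivity, hδ⟩ _ ?_ _ (hct k).contDiff ?_ _ ?_
    · calc _ ≤ dist y (node ε k) + dist y q := dist_triangle_left _ _ _
        _ ≤ D * ε + l := add_le_add hdk hdq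
        _ ≤ _ := by nlinarith
    · refine ((tsupport_cut_subset _ _ _).trans inter_subset_right).trans
        (hq.trans (closedBall_subset_closedBall ?_))
      nlinarith
    · refine DerivBound.mul_scale ?_ hl (by linarith)
      have h1 : DerivBound r l (2 ^ r * A) (cell ε k) := by
        have h2 : 2 * ε / 1 = 2 * ε := by ring
        exact ((hA ε hε k).mul_scale hε one_le_two).scale_mono hl hlε
      exact hB.cut hh.contDiff hl h1
  rw [latticeSum_eq_sum hG hε hεl hq, e1, ← Finset.sum_sub_distrib]
  calc _ ≤ ∑ _k ∈ box ε q l, P := norm_sum_le_of_le _ fun k _ => hterm k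
    _ ≤ 10 ^ d * P := by
        rw [Finset.sum_const, nsmul_eq_mul]
        gcongr
        refine (card_box_le hε hεl q).trans ?_
        gcongr
        have : l / ε ≤ 2 := (div_le_iff₀ hε).2 hlε
        linarith
    _ = _ := by
        rw [hP, Real.mul_rpow (by positivity) hl.le]
        ring

end Lattice

end GermReconstruction

end

noncomputable section

namespace GermReconstruction

open Set Filter Topology MeasureTheory Metric

section Reconstruction

variable {𝕜 : Type*} [RCLike 𝕜] {d : ℕ}

variable {γ : ℝ} {W : Set (E d)} {G : E d → (E d → 𝕜) → 𝕜}

/-- For test functions supported in a fixed compact set, the successive differences of the dyadic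
approximations decay geometrically. -/
lemma StronglyCoherent.exists_norm_latticeSum_succ_sub_le (hW : IsOpen W)
    (hG : ∀ p, IsDistrOn (G p) W) (hcoh : StronglyCoherent γ W G) {K : Set (E d)}
    (hK : IsCompact K) (hKW : K ⊆ W) :
    ∃ r : ℕ, ∃ Q ε₀ : ℝ, 0 ≤ Q ∧ 0 < ε₀ ∧ ∀ (h : E d → 𝕜) (x : E d) (l B : ℝ), ContDiff ℝ ∞ h →
      tsupport h ⊆ K → tsupport h ⊆ closedBall x l → DerivBound r l B h →
      ∀ n : ℕ, (1 / 2 : ℝ) ^ n ≤ ε₀ → (1 / 2 : ℝ) ^ n ≤ l →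
        ‖latticeSum G ((1 / 2) ^ (n + 1)) h - latticeSum G ((1 / 2) ^ n) h‖ ≤
          Q * B * l ^ d * ((1 / 2) ^ n) ^ γ := by
  obtain ⟨ρ, hρ, hρW⟩ := hK.exists_cthickening_subset_open hW hKW
  obtain ⟨r, C, δ, hC, hδ, hS⟩ := hcoh _ hK.cthickening hρW
  obtain ⟨Q, hQ, h1⟩ := exists_norm_latticeSum_half_sub_le (𝕜 := 𝕜) d r γ
  have hD : (0 : ℝ) < d + 1 := by positivity
  refine ⟨r, Q * C, min (ρ / (d + 1)) (δ / (2 * (d + 1))), by positivity,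
    lt_min (by positivity) (by positivity), fun h x l B hh hhK hx hB n hn hnl => ?_⟩
  have hε : (0 : ℝ) < (1 / 2) ^ n := by positivity
  have h2 : (1 / 2 : ℝ) ^ (n + 1) = (1 / 2) ^ n / 2 := by rw [pow_succ]; ring
  rw [h2]
  refine h1 W _ G C δ hG hC hS h x l _ B (.of_subset_compact hh hK hhK hKW) hx hε hnl ?_
    (fun k hk => ?_) hB
  · have := (le_div_iff₀ (by positivity)).1 (hn.trans (min_le_right _ _))
    linarith
  · obtain ⟨y, hyk, hy⟩ := exists_of_cut_ne_zero hk
    refine mem_cthickening_of_dist_le _ y _ _ (hhK (subset_tsupport _ hy)) ?_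
    rw [dist_comm]
    refine (dist_node_le_of_cell_ne_zero hε hyk).trans ?_
    have := (le_div_iff₀ (by positivity)).1 (hn.trans (min_le_left _ _))
    linarith

/-- A sequence with geometrically decaying differences converges, with a rate. -/
lemma exists_tendsto_norm_sub_le {u : ℕ → 𝕜} {c ρ : ℝ} (hρ1 : ρ < 1) {N : ℕ}
    (h : ∀ n ≥ N, ‖u (n + 1) - u n‖ ≤ c * ρ ^ (n - N)) :
    ∃ a, Tendsto u atTop (𝓝 a) ∧ ‖a - u N‖ ≤ c / (1 - ρ) := by
  have h1 : ∀ n, dist (u (n + N)) (u (n + 1 + N)) ≤ c * ρ ^ n := fun n => by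
    have := h (n + N) (by omega)
    rwa [Nat.add_sub_cancel, ← dist_eq_norm, dist_comm, add_right_comm] at this
  obtain ⟨a, ha⟩ := cauchySeq_tendsto_of_complete (cauchySeq_of_le_geometric ρ c hρ1 h1)
  refine ⟨a, (tendsto_add_atTop_iff_nat N).1 ha, ?_⟩
  have := dist_le_of_le_geometric_of_tendsto₀ ρ c hρ1 h1 ha
  rwa [dist_comm, dist_eq_norm, zero_add] at this

/-- Multiplication by a function of the partition of unity preserves the boundedness of a
distribution on test functions with support in `K`. -/
lemma IsDistrOn.exists_bound_cut {T : (E d → 𝕜) → 𝕜} (hT : IsDistrOn T W) {K : Set (E d)}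
    (hK : IsCompact K) (hKW : K ⊆ W) {ε : ℝ} (hε : 0 < ε) (k : Fin d → ℤ) :
    ∃ m : ℕ, ∃ C : ℝ, 0 ≤ C ∧ ∀ h, ContDiff ℝ ∞ h → tsupport h ⊆ K → ∀ B, DerivBound m 1 B h →
      ‖T (cut ε k h)‖ ≤ C * B := by
  obtain ⟨m, C, hC, h1⟩ := hT.bound K hK hKW
  obtain ⟨A, hA⟩ := exists_derivBound (contDiff_cell ε k)
    ((isCompact_closedBall _ _).of_isClosed_subset (isClosed_tsupport _)
      (tsupport_cell_subset hε k)) m one_pos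
  have hA0 := hA.nonneg
  refine ⟨m, C * (2 ^ m * A), by positivity, fun h hh hhK B hB => ?_⟩
  rw [mul_assoc]
  exact h1 _ ((contDiff_cell ε k).smul hh) ((tsupport_cut_subset _ _ _).trans
    (inter_subset_right.trans hhK)) _ (hB.cut hh one_pos hA)

/-- The reconstruction theorem on an open subset of `ℝ^d`, for strongly coherent germs. -/
theorem StronglyCoherent.exists_stronglyReconstructs (hγ : 0 < γ) (hW : IsOpen W)
    (hG : ∀ p, IsDistrOn (G p) W) (hcoh : StronglyCoherent γ W G) :
    ∃ R, IsDistrOn R W ∧ StronglyReconstructs γ W G R := by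
  set ρ : ℝ := (1 / 2 : ℝ) ^ γ with hρ
  have hρ0 : 0 < ρ := by positivity
  have hρ1 : ρ < 1 := Real.rpow_lt_one (by norm_num) (by norm_num) hγ
  have hρpow : ∀ n : ℕ, ((1 / 2 : ℝ) ^ n) ^ γ = ρ ^ n := fun n => by
    rw [hρ, ← Real.rpow_natCast, ← Real.rpow_natCast, ← Real.rpow_mul (by norm_num),
      ← Real.rpow_mul (by norm_num), mul_comm]
  have hpow : Tendsto (fun n : ℕ => (1 / 2 : ℝ) ^ n) atTop (𝓝 0) :=
    tendsto_pow_atTop_nhds_zero_of_lt_one (by norm_num) (by norm_num)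
  have hρ' : 0 < 1 - ρ := by linarith
  -- The approximations converge, with a rate that is uniform over compact sets of supports.
  have hconv : ∀ K : Set (E d), IsCompact K → K ⊆ W → ∃ r : ℕ, ∃ Q ε₀ : ℝ, 0 ≤ Q ∧ 0 < ε₀ ∧
      ∀ (h : E d → 𝕜) (x : E d) (l B : ℝ), ContDiff ℝ ∞ h →
      tsupport h ⊆ K → tsupport h ⊆ closedBall x l → DerivBound r l B h →
      ∀ n : ℕ, (1 / 2 : ℝ) ^ n ≤ ε₀ → (1 / 2 : ℝ) ^ n ≤ l →
        ∃ a, Tendsto (fun n : ℕ => latticeSum G ((1 / 2) ^ n) h) atTop (𝓝 a) ∧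
          ‖a - latticeSum G ((1 / 2) ^ n) h‖ ≤ Q * B * l ^ d * ((1 / 2) ^ n) ^ γ := by
    intro K hK hKW
    obtain ⟨r, Q, ε₀, hQ, hε₀, h1⟩ := hcoh.exists_norm_latticeSum_succ_sub_le hW hG hK hKW
    refine ⟨r, Q / (1 - ρ), ε₀, by positivity, hε₀, fun h x l B hh hhK hx hB N hN hNl => ?_⟩
    obtain ⟨a, ha, ha'⟩ := exists_tendsto_norm_sub_le
      (u := fun n : ℕ => latticeSum G ((1 / 2) ^ n) h)
      (c := Q * B * l ^ d * ((1 / 2) ^ N) ^ γ) (N := N) hρ1 fun n hn => by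
        have hle : (1 / 2 : ℝ) ^ n ≤ (1 / 2) ^ N :=
          pow_le_pow_of_le_one (by norm_num) (by norm_num) hn
        refine (h1 h x l B hh hhK hx hB n (hle.trans hN) (hle.trans hNl)).trans (le_of_eq ?_)
        rw [hρpow, hρpow, mul_assoc _ (ρ ^ N), ← pow_add, Nat.add_sub_cancel' hn]
    exact ⟨a, ha, ha'.trans (le_of_eq (by ring))⟩
  have hball : ∀ K : Set (E d), IsCompact K → ∃ l : ℝ, 1 ≤ l ∧ K ⊆ closedBall 0 l := by
    intro K hK
    obtain ⟨l, hl⟩ := hK.isBounded.subset_closedBall 0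
    exact ⟨max l 1, le_max_right _ _, hl.trans (closedBall_subset_closedBall (le_max_left _ _))⟩
  have hN : ∀ ε₀ : ℝ, 0 < ε₀ → ∃ N : ℕ, (1 / 2 : ℝ) ^ N ≤ ε₀ := fun ε₀ hε₀ =>
    ((hpow.eventually (gt_mem_nhds hε₀)).exists).imp fun _ h => h.le
  have hle1 : ∀ n : ℕ, (1 / 2 : ℝ) ^ n ≤ 1 := fun n => pow_le_one₀ (by norm_num) (by norm_num)
  have hex : ∀ h, IsTest W h → ∃ a, Tendsto (fun n : ℕ => latticeSum G ((1 / 2) ^ n) h) atTop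
      (𝓝 a) := by
    intro h hh
    obtain ⟨r, Q, ε₀, -, hε₀, h1⟩ := hconv _ hh.compact.isCompact hh.subset
    obtain ⟨l, hl, hhl⟩ := hball _ hh.compact.isCompact
    obtain ⟨B, hB⟩ := hh.exists_derivBound r (one_pos.trans_le hl)
    obtain ⟨N, hN⟩ := hN ε₀ hε₀
    obtain ⟨a, ha, -⟩ := h1 h 0 l B hh.contDiff le_rfl hhl hB N hN ((hle1 N).trans hl)
    exact ⟨a, ha⟩
  set R : (E d → 𝕜) → 𝕜 := fun h => limUnder atTop fun n : ℕ => latticeSum G ((1 / 2) ^ n) h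
    with hR
  have hlim : ∀ h, IsTest W h →
      Tendsto (fun n : ℕ => latticeSum G ((1 / 2) ^ n) h) atTop (𝓝 (R h)) := fun h hh =>
    tendsto_nhds_limUnder (hex h hh)
  have hdist : IsDistrOn R W := by
    refine ⟨fun f g hf hg => ?_, fun c f hf => ?_, fun K hK hKW => ?_⟩
    · obtain ⟨l, hl, hKl⟩ := hball _ (hf.compact.isCompact.union hg.compact.isCompact)
      refine tendsto_nhds_unique (hlim _ (hf.add hg)) (((hlim f hf).add (hlim g hg)).congr
        fun n => ?_)
      have hn : (1 / 2 : ℝ) ^ n ≤ l := (hle1 n).trans hl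
      rw [latticeSum_eq_sum hG (by positivity) hn (subset_union_left.trans hKl),
        latticeSum_eq_sum hG (by positivity) hn (subset_union_right.trans hKl),
        latticeSum_eq_sum (h := f + g) hG (by positivity) hn ((tsupport_add f g).trans hKl),
        ← Finset.sum_add_distrib]
      refine Finset.sum_congr rfl fun k _ => ?_
      rw [← (hG _).map_add _ _ (hf.cut _ k) (hg.cut _ k)]
      congr 1
      ext y; simp [cut]
    · obtain ⟨l, hl, hKl⟩ := hball _ hf.compact.isCompact
      refine tendsto_nhds_unique (hlim _ (hf.const_smul c)) (((hlim f hf).const_mul c).congr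
        fun n => ?_)
      have hn : (1 / 2 : ℝ) ^ n ≤ l := (hle1 n).trans hl
      rw [latticeSum_eq_sum hG (by positivity) hn hKl,
        latticeSum_eq_sum hG (by positivity) hn
          ((closure_mono (Function.support_const_smul_subset c f)).trans hKl), Finset.mul_sum]
      refine Finset.sum_congr rfl fun k _ => ?_
      rw [← (hG _).map_smul _ _ (hf.cut _ k)]
      congr 1
      ext y; simp only [cut, Pi.smul_apply]; rw [smul_comm]
    · obtain ⟨r, Q, ε₀, hQ, hε₀, h1⟩ := hconv K hK hKW
      obtain ⟨l, hl, hKl⟩ := hball K hK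
      have hl0 : 0 < l := one_pos.trans_le hl
      obtain ⟨N, hN⟩ := hN ε₀ hε₀
      have hNl : (1 / 2 : ℝ) ^ N ≤ l := (hle1 N).trans hl
      have hb : ∀ k : Fin d → ℤ, _ := fun k =>
        (hG (node ((1 / 2) ^ N) k)).exists_bound_cut hK hKW (ε := (1 / 2) ^ N) (by positivity) k
      choose m C hC hm using hb
      set b := box ((1 / 2) ^ N) (0 : E d) l with hb
      refine ⟨max r (b.sup m), Q * l ^ r * l ^ d * ((1 / 2) ^ N) ^ γ + ∑ k ∈ b, C k,
        add_nonneg (by positivity) (Finset.sum_nonneg fun k _ => hC k),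
        fun g hg hgK B hB => ?_⟩
      have hg' : IsTest W g := .of_subset_compact hg hK hgK hKW
      have hB1 : DerivBound r l (l ^ r * B) g := by
        simpa using (hB.order_mono (le_max_left _ _)).mul_scale one_pos hl
      obtain ⟨a, ha, ha'⟩ := h1 g 0 l _ hg hgK (hgK.trans hKl) hB1 N hN hNl
      rw [tendsto_nhds_unique ha (hlim g hg')] at ha'
      have h2 : ‖latticeSum G ((1 / 2) ^ N) g‖ ≤ (∑ k ∈ b, C k) * B := by
        rw [latticeSum_eq_sum hG (by positivity) hNl (hgK.trans hKl), Finset.sum_mul]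
        exact norm_sum_le_of_le _ fun k hk => hm k g hg hgK B
          (hB.order_mono ((Finset.le_sup (f := m) hk).trans (le_max_right _ _)))
      calc ‖R g‖ = ‖(R g - latticeSum G ((1 / 2) ^ N) g) + latticeSum G ((1 / 2) ^ N) g‖ := by
            congr 1; ring
        _ ≤ _ := (norm_add_le _ _).trans (add_le_add ha' h2)
        _ = _ := by ring
  refine ⟨R, hdist, fun K hK hKW => ?_⟩
  obtain ⟨η, hη, hηW⟩ := hK.exists_cthickening_subset_open hW hKW
  obtain ⟨r, Q, ε₀, hQ, hε₀, h1⟩ := hconv _ hK.cthickening hηW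
  obtain ⟨r', C, δ, hC, hδ, hS⟩ := hcoh K hK hKW
  obtain ⟨Q', hQ', h2⟩ := exists_norm_latticeSum_sub_apply_le (𝕜 := 𝕜) d r' γ
  refine ⟨max r r', Q + Q' * C, min (min η 1) (min ε₀ (δ / (2 * (d + 1)))), by positivity,
    lt_min (lt_min hη one_pos) (lt_min hε₀ (by positivity)), fun q hq l hl g hg hgq B hB => ?_⟩
  have hl0 : 0 < l := hl.1
  have hB0 := hB.nonneg
  have hlη : l ≤ η := hl.2.trans ((min_le_left _ _).trans (min_le_left _ _))
  have hl1 : l ≤ 1 := hl.2.trans ((min_le_left _ _).trans (min_le_right _ _))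
  have hlε : l ≤ ε₀ := hl.2.trans ((min_le_right _ _).trans (min_le_left _ _))
  have hlδ : 2 * (d + 1) * l ≤ δ := by
    have := (le_div_iff₀ (by positivity)).1 (hl.2.trans ((min_le_right _ _).trans (min_le_right _ _)))
    linarith
  have hqK : closedBall q l ⊆ cthickening η K :=
    (closedBall_subset_closedBall hlη).trans (closedBall_subset_cthickening hq η)
  have hg' : IsTest W g :=
    .of_subset_compact hg hK.cthickening (hgq.trans hqK) hηW
  obtain ⟨n, hn1, hn2⟩ := exists_nat_pow_near_of_lt_one hl0 hl1 (y := (1 / 2 : ℝ)) (by norm_num)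
    (by norm_num)
  obtain ⟨a, ha, ha'⟩ := h1 g q l B hg (hgq.trans hqK) hgq (hB.order_mono (le_max_left _ _))
    (n + 1) (hn1.le.trans hlε) hn1.le
  rw [tendsto_nhds_unique ha (hlim g hg')] at ha'
  have h3 := h2 W K G C δ hG hC hS g q l ((1 / 2) ^ (n + 1)) B hg' hgq hq (by positivity) hn1.le
    (by rw [pow_succ]; linarith) hlδ (hB.order_mono (le_max_right _ _))
  calc ‖R g - G q g‖ = ‖(R g - latticeSum G ((1 / 2) ^ (n + 1)) g) +
        (latticeSum G ((1 / 2) ^ (n + 1)) g - G q g)‖ := by congr 1; ring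
    _ ≤ Q * B * l ^ d * l ^ γ + Q' * C * B * l ^ (γ + d) := by
        refine (norm_add_le _ _).trans (add_le_add (ha'.trans ?_) h3)
        gcongr
    _ = _ := by rw [Real.rpow_add hl0, Real.rpow_natCast]; ring

end Reconstruction

end GermReconstruction

end

noncomputable section

namespace GermReconstruction

open Set Filter Topology MeasureTheory Metric

/-! ### Transport of test functions by a diffeomorphism -/

section Transport

variable {𝕜 : Type*} [RCLike 𝕜] {d : ℕ}

lemma contDiff_det : ContDiff ℝ ∞ fun A : E d →L[ℝ] E d => A.det := by
  have h : (fun A : E d →L[ℝ] E d => A.det) = fun A : E d →L[ℝ] E d =>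
      ∑ σ : Equiv.Perm (Fin d), Equiv.Perm.sign σ • ∏ i, (A (EuclideanSpace.single i 1)) (σ i) := by
    ext A
    rw [ContinuousLinearMap.det, ← LinearMap.det_toMatrix (EuclideanSpace.basisFun (Fin d) ℝ).toBasis,
      Matrix.det_apply]
    refine Finset.sum_congr rfl fun σ _ => ?_
    simp [LinearMap.toMatrix_apply]
  rw [h]
  refine ContDiff.sum fun σ _ => ContDiff.const_smul _ (contDiff_prod fun i _ => ?_)
  exact (contDiff_piLp_apply (p := 2) (i := σ i)).comp (contDiff_id.clm_apply contDiff_const)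

/-- The two inverse maps of `χ` are smooth on their domains. -/
structure IsDiffeo (χ : OpenPartialHomeomorph (E d) (E d)) : Prop where
  contDiffOn : ContDiffOn ℝ ∞ χ χ.source
  contDiffOn_symm : ContDiffOn ℝ ∞ χ.symm χ.target

/-- The Jacobian factor of the transport by `χ`. -/
def jacobian (χ : OpenPartialHomeomorph (E d) (E d)) (y : E d) : ℝ := |(fderiv ℝ χ.symm y).det|

lemma transport_apply_of_mem {χ : OpenPartialHomeomorph (E d) (E d)} (h : E d → 𝕜) {y : E d}
    (hy : y ∈ χ.target) : transport χ h y = jacobian χ y • h (χ.symm y) :=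
  indicator_of_mem hy _

lemma transport_add (χ : OpenPartialHomeomorph (E d) (E d)) (f g : E d → 𝕜) :
    transport χ (f + g) = transport χ f + transport χ g := by
  ext y
  by_cases hy : y ∈ χ.target <;> simp [transport, hy]

lemma transport_smul (χ : OpenPartialHomeomorph (E d) (E d)) (c : 𝕜) (f : E d → 𝕜) :
    transport χ (c • f) = c • transport χ f := by
  ext y
  by_cases hy : y ∈ χ.target
  · simp only [transport, hy, indicator_of_mem, Pi.smul_apply]; rw [smul_comm]
  · simp [transport, hy]

lemma tsupport_transport_subset {χ : OpenPartialHomeomorph (E d) (E d)} {h : E d → 𝕜}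
    (hc : HasCompactSupport h) (hs : tsupport h ⊆ χ.source) :
    tsupport (transport χ h) ⊆ χ '' tsupport h := by
  refine closure_minimal (fun y hy => ?_)
    (hc.isCompact.image_of_continuousOn (χ.continuousOn.mono hs)).isClosed
  have hyt : y ∈ χ.target := by
    by_contra h0
    exact hy (indicator_of_notMem h0 _)
  rw [Function.mem_support, transport_apply_of_mem h hyt] at hy
  exact ⟨χ.symm y, subset_tsupport _ (smul_ne_zero_iff.1 hy).2, χ.right_inv hyt⟩

namespace IsDiffeo

variable {χ : OpenPartialHomeomorph (E d) (E d)}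

lemma contDiffOn_jacobian (hχ : IsDiffeo χ) : ContDiffOn ℝ ∞ (jacobian χ) χ.target := by
  have h1 : ContDiffOn ℝ ∞ (fun y => (fderiv ℝ χ.symm y).det) χ.target :=
    contDiff_det.comp_contDiffOn
      (hχ.contDiffOn_symm.fderiv_of_isOpen χ.open_target (m := ∞) (by simp))
  refine fun y hy => (contDiffAt_abs ?_).comp_contDiffWithinAt y (h1 y hy)
  have hx : χ.symm y ∈ χ.source := χ.map_target hy
  have hd : HasFDerivAt χ.symm (fderiv ℝ χ.symm y) y :=
    ((hχ.contDiffOn_symm.contDiffAt (χ.open_target.mem_nhds hy)).differentiableAt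
      (by simp)).hasFDerivAt
  have hd' : HasFDerivAt χ (fderiv ℝ χ (χ.symm y)) (χ.symm y) :=
    ((hχ.contDiffOn.contDiffAt (χ.open_source.mem_nhds hx)).differentiableAt
      (by simp)).hasFDerivAt
  have hid : (fderiv ℝ χ (χ.symm y)).comp (fderiv ℝ χ.symm y) = ContinuousLinearMap.id ℝ (E d) := by
    refine (hd'.comp y hd).unique ((hasFDerivAt_id y).congr_of_eventuallyEq ?_)
    filter_upwards [χ.open_target.mem_nhds hy] with z hz
    exact χ.right_inv hz
  intro h0
  have h2 : ((fderiv ℝ χ (χ.symm y)).comp (fderiv ℝ χ.symm y)).det = 1 := by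
    rw [hid]; exact LinearMap.det_id
  have h3 : ((fderiv ℝ χ (χ.symm y)).comp (fderiv ℝ χ.symm y)).det =
      (fderiv ℝ χ (χ.symm y)).det * (fderiv ℝ χ.symm y).det :=
    LinearMap.det_comp _ _
  rw [h3, h0, mul_zero] at h2
  exact zero_ne_one h2

lemma isTest_transport (hχ : IsDiffeo χ) {h : E d → 𝕜} (hh : IsTest χ.source h) :
    IsTest χ.target (transport χ h) := by
  have hsub := tsupport_transport_subset hh.compact hh.subset
  have himg : IsCompact (χ '' tsupport h) :=
    hh.compact.isCompact.image_of_continuousOn (χ.continuousOn.mono hh.subset)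
  refine .of_subset_compact (contDiff_iff_contDiffAt.2 fun y => ?_) himg hsub ?_
  · by_cases hy : y ∈ χ.target
    · have h1 : ContDiffOn ℝ ∞ (fun y => jacobian χ y • h (χ.symm y)) χ.target :=
        hχ.contDiffOn_jacobian.smul (hh.contDiff.comp_contDiffOn hχ.contDiffOn_symm)
      refine (h1.contDiffAt (χ.open_target.mem_nhds hy)).congr_of_eventuallyEq ?_
      filter_upwards [χ.open_target.mem_nhds hy] with z hz
      exact transport_apply_of_mem h hz
    · have hy' : y ∉ tsupport (transport χ h) := fun h0 => by
        obtain ⟨x, hx, rfl⟩ := hsub h0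
        exact hy (χ.map_source (hh.subset hx))
      exact contDiffAt_const.congr_of_eventuallyEq (notMem_tsupport_iff_eventuallyEq.1 hy')
  · rintro _ ⟨x, hx, rfl⟩
    exact χ.map_source (hh.subset hx)

/-- The transport preserves bounds at scales `l ≤ 1`, uniformly over test functions with support in
a compact set. -/
lemma exists_derivBound_transport (hχ : IsDiffeo χ) {K : Set (E d)} (hK : IsCompact K)
    (hKs : K ⊆ χ.source) (r : ℕ) : ∃ A : ℝ, 0 ≤ A ∧ ∀ h : E d → 𝕜, ContDiff ℝ ∞ h →
      tsupport h ⊆ K → ∀ l ∈ Ioc (0 : ℝ) 1, ∀ B, DerivBound r l B h →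
        DerivBound r l (A * B) (transport χ h) := by
  have hL : IsCompact (χ '' K) := hK.image_of_continuousOn (χ.continuousOn.mono hKs)
  have hLt : χ '' K ⊆ χ.target := by
    rintro _ ⟨x, hx, rfl⟩
    exact χ.map_source (hKs hx)
  have hu := χ.open_target.uniqueDiffOn (𝕜 := ℝ)
  have hbd : ∀ {V : Type} [NormedAddCommGroup V] [NormedSpace ℝ V] {f : E d → V},
      ContDiffOn ℝ ∞ f χ.target → ∃ C : ℝ, 1 ≤ C ∧ ∀ i ≤ r, ∀ y ∈ χ '' K,
        ‖iteratedFDerivWithin ℝ i f χ.target y‖ ≤ C := by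
    intro V _ _ f hf
    have h1 : ∀ i : ℕ, ∃ C, ∀ y ∈ χ '' K, ‖iteratedFDerivWithin ℝ i f χ.target y‖ ≤ C := fun i =>
      hL.exists_bound_of_continuousOn
        ((hf.continuousOn_iteratedFDerivWithin (mod_cast le_top) hu).mono hLt)
    choose C hC using h1
    refine ⟨∑ i ∈ Finset.range (r + 1), |C i| + 1, by
      linarith [Finset.sum_nonneg fun i (_ : i ∈ Finset.range (r + 1)) => abs_nonneg (C i)],
      fun i hi y hy => (hC i y hy).trans ?_⟩
    have := Finset.single_le_sum (f := fun i => |C i|) (fun j _ => abs_nonneg (C j))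
      (Finset.mem_range.2 (Nat.lt_succ_of_le hi))
    have h2 := le_abs_self (C i)
    linarith
  obtain ⟨J, hJ1, hJ⟩ := hbd hχ.contDiffOn_jacobian
  obtain ⟨D, hD1, hD⟩ := hbd hχ.contDiffOn_symm
  refine ⟨∑ i ∈ Finset.range (r + 1), ∑ j ∈ Finset.range (i + 1),
    (i.choose j : ℝ) * J * ((i - j).factorial * D ^ (i - j)), by positivity,
    fun h hh hhK l hl B hB i hi y => ?_⟩
  have hl0 := hl.1
  have hB0 := hB.nonneg
  have hl1 : 1 ≤ l⁻¹ := (one_le_inv₀ hl.1).2 hl.2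
  have hh' : IsTest χ.source h := .of_subset_compact hh hK hhK hKs
  by_cases hy : y ∈ χ '' K
  swap
  · have h0 : iteratedFDeriv ℝ i (transport χ h) y = 0 := by
      by_contra h0
      refine hy (image_mono hhK (tsupport_transport_subset hh'.compact hh'.subset ?_))
      exact support_iteratedFDeriv_subset i h0
    rw [h0, norm_zero]
    positivity
  have hyt := hLt hy
  have hcomp : ContDiffOn ℝ ∞ (h ∘ χ.symm) χ.target := hh.comp_contDiffOn hχ.contDiffOn_symm
  have h1 : iteratedFDeriv ℝ i (transport χ h) y =
      iteratedFDerivWithin ℝ i (fun y => jacobian χ y • (h ∘ χ.symm) y) χ.target y := by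
    rw [← iteratedFDerivWithin_of_isOpen i χ.open_target hyt]
    exact iteratedFDerivWithin_congr (fun z hz => transport_apply_of_mem h hz) hyt i
  rw [h1]
  refine (norm_iteratedFDerivWithin_smul_le hχ.contDiffOn_jacobian hcomp hu hyt
    (n := i) (mod_cast le_top)).trans ?_
  have h2 : ∀ n ≤ i, ‖iteratedFDerivWithin ℝ n (h ∘ χ.symm) χ.target y‖ ≤
      n.factorial * (B * l⁻¹ ^ i) * D ^ n := by
    intro n hn
    refine norm_iteratedFDerivWithin_comp_le hh.contDiffOn hχ.contDiffOn_symm (t := univ)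
      (N := ∞) (mod_cast le_top) uniqueDiffOn_univ hu (mapsTo_univ _ _) hyt (fun k hk => ?_)
      fun k hk1 hk => ?_
    · rw [iteratedFDerivWithin_univ]
      refine (hB k (by omega) _).trans ?_
      gcongr
      omega
    · exact (hD k (by omega) y hy).trans (le_self_pow₀ hD1 (by omega))
  calc _ ≤ ∑ j ∈ Finset.range (i + 1), (i.choose j : ℝ) * J *
        ((i - j).factorial * (B * l⁻¹ ^ i) * D ^ (i - j)) := by
        refine Finset.sum_le_sum fun j hj => ?_
        have hj' : j ≤ i := Nat.lt_succ_iff.1 (Finset.mem_range.1 hj)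
        have h3 := hJ j (hj'.trans hi) y hy
        have h4 := h2 (i - j) (Nat.sub_le _ _)
        gcongr
    _ = (∑ j ∈ Finset.range (i + 1), (i.choose j : ℝ) * J * ((i - j).factorial * D ^ (i - j))) *
          (B * l⁻¹ ^ i) := by
        rw [Finset.sum_mul]
        exact Finset.sum_congr rfl fun j _ => by ring
    _ ≤ _ := by
        rw [mul_assoc _ B]
        refine mul_le_mul_of_nonneg_right ?_ (by positivity)
        exact Finset.single_le_sum (f := fun i => ∑ j ∈ Finset.range (i + 1),
          (i.choose j : ℝ) * J * ((i - j).factorial * D ^ (i - j)))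
          (fun j _ => by positivity) (Finset.mem_range.2 (Nat.lt_succ_of_le hi))

lemma exists_lipschitz (hχ : IsDiffeo χ) {K : Set (E d)} (hK : IsCompact K)
    (hKs : K ⊆ χ.source) : ∃ L δ : ℝ, 1 ≤ L ∧ 0 < δ ∧ ∀ q ∈ K, closedBall q δ ⊆ χ.source ∧
      ∀ p ∈ closedBall q δ, dist (χ p) (χ q) ≤ L * dist p q := by
  obtain ⟨δ, hδ, hδs⟩ := hK.exists_cthickening_subset_open χ.open_source hKs
  obtain ⟨L, hL⟩ := (hK.cthickening (r := δ)).exists_bound_of_continuousOn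
    ((hχ.contDiffOn.fderiv_of_isOpen χ.open_source (m := ∞) (by simp)).continuousOn.mono hδs)
  refine ⟨max L 1, δ, le_max_right _ _, hδ, fun q hq => ?_⟩
  have hb : closedBall q δ ⊆ cthickening δ K := closedBall_subset_cthickening hq δ
  refine ⟨hb.trans hδs, fun p hp => ?_⟩
  rw [dist_eq_norm, dist_eq_norm]
  refine Convex.norm_image_sub_le_of_norm_fderiv_le (𝕜 := ℝ) (s := closedBall q δ)
    (fun z hz => ?_) (fun z hz => (hL z (hb hz)).trans (le_max_left _ _))
    (convex_closedBall q δ) (mem_closedBall_self hδ.le) hp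
  exact (hχ.contDiffOn.contDiffAt (χ.open_source.mem_nhds (hδs (hb hz)))).differentiableAt
    (by simp)

/-- A diffeomorphism distorts scales and the bounds at small scales by constant factors only. -/
lemma exists_transport_scale (hχ : IsDiffeo χ) {K : Set (E d)} (hK : IsCompact K)
    (hKs : K ⊆ χ.source) (r : ℕ) : ∃ A L δ : ℝ, 0 ≤ A ∧ 1 ≤ L ∧ 0 < δ ∧
      ∀ q ∈ K, ∀ l ∈ Ioc 0 δ, (∀ p, dist p q ≤ l → p ∈ χ.source ∧ dist (χ p) (χ q) ≤ L * l) ∧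
        ∀ g : E d → 𝕜, ContDiff ℝ ∞ g → tsupport g ⊆ closedBall q l → IsTest χ.source g ∧
          tsupport (transport χ g) ⊆ closedBall (χ q) (L * l) ∧
          ∀ B, DerivBound r l B g → DerivBound r (L * l) (A * B) (transport χ g) := by
  obtain ⟨L, δ, hL1, hδ, hL⟩ := hχ.exists_lipschitz hK hKs
  obtain ⟨ρ, hρ, hρs⟩ := hK.exists_cthickening_subset_open χ.open_source hKs
  obtain ⟨A, hA, h1⟩ := hχ.exists_derivBound_transport (𝕜 := 𝕜) hK.cthickening hρs r
  refine ⟨L ^ r * A, L, min δ (min ρ 1), by positivity, hL1, lt_min hδ (lt_min hρ one_pos),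
    fun q hq l hl => ?_⟩
  have hlδ : l ≤ δ := hl.2.trans (min_le_left _ _)
  have hlρ : l ≤ ρ := hl.2.trans ((min_le_right _ _).trans (min_le_left _ _))
  have hl1 : l ≤ 1 := hl.2.trans ((min_le_right _ _).trans (min_le_right _ _))
  have hp : ∀ p, dist p q ≤ l → p ∈ χ.source ∧ dist (χ p) (χ q) ≤ L * l := fun p hp =>
    ⟨(hL q hq).1 (hp.trans hlδ), ((hL q hq).2 p (hp.trans hlδ)).trans (by gcongr)⟩
  refine ⟨hp, fun g hg hgq => ?_⟩
  have hgt : IsTest χ.source g := .of_subset_compact hg (isCompact_closedBall q l) hgq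
    fun p h => (hp p h).1
  refine ⟨hgt, (tsupport_transport_subset hgt.compact hgt.subset).trans ?_, fun B hB => ?_⟩
  · rintro _ ⟨x, hx, rfl⟩
    exact (hp x (hgq hx)).2
  · rw [mul_assoc]
    exact (h1 g hg (hgq.trans ((closedBall_subset_closedBall hlρ).trans
      (closedBall_subset_cthickening hq ρ))) l ⟨hl.1, hl1⟩ B hB).mul_scale hl.1 hL1

variable {γ : ℝ} {G : E d → (E d → 𝕜) → 𝕜} {R : (E d → 𝕜) → 𝕜}

/-- The pull-back of a distribution by a diffeomorphism. -/
lemma isDistrOn_comp_transport (hχ : IsDiffeo χ) (hR : IsDistrOn R χ.target) :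
    IsDistrOn (fun h => R (transport χ h)) χ.source := by
  refine ⟨fun f g hf hg => ?_, fun c f hf => ?_, fun K hK hKs => ?_⟩
  · rw [transport_add]
    exact hR.map_add _ _ (hχ.isTest_transport hf) (hχ.isTest_transport hg)
  · rw [transport_smul]
    exact hR.map_smul _ _ (hχ.isTest_transport hf)
  · obtain ⟨m, C, hC, h1⟩ := hR.bound (χ '' K)
      (hK.image_of_continuousOn (χ.continuousOn.mono hKs)) (by
        rintro _ ⟨x, hx, rfl⟩
        exact χ.map_source (hKs hx))
    obtain ⟨A, hA, h2⟩ := hχ.exists_derivBound_transport (𝕜 := 𝕜) hK hKs m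
    refine ⟨m, C * A, by positivity, fun g hg hgK B hB => ?_⟩
    have hgt : IsTest χ.source g := .of_subset_compact hg hK hgK hKs
    rw [mul_assoc]
    exact h1 _ (hχ.isTest_transport hgt).contDiff ((tsupport_transport_subset hgt.compact
      hgt.subset).trans (image_mono hgK)) _ (h2 g hg hgK 1 (by simp) B hB)

/-- Strong coherence is invariant under diffeomorphisms. -/
lemma stronglyCoherent_comp (hχ : IsDiffeo χ) (hG : StronglyCoherent γ χ.target G) :
    StronglyCoherent γ χ.source fun x h => G (χ x) (transport χ h) := by
  intro K hK hKs
  obtain ⟨r, C, δ, hC, hδ, h1⟩ := hG (χ '' K)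
    (hK.image_of_continuousOn (χ.continuousOn.mono hKs)) (by
      rintro _ ⟨x, hx, rfl⟩
      exact χ.map_source (hKs hx))
  obtain ⟨A, L, δ', hA, hL, hδ', h2⟩ := hχ.exists_transport_scale (𝕜 := 𝕜) hK hKs r
  have hL0 : 0 < L := one_pos.trans_le hL
  refine ⟨r, C * A * L ^ (γ + d), min δ' (δ / L), by positivity,
    lt_min hδ' (by positivity), fun q hq l hl p hp g hg hgq B hB => ?_⟩
  obtain ⟨h3, h4⟩ := h2 q hq l ⟨hl.1, hl.2.trans (min_le_left _ _)⟩
  obtain ⟨h5, h6, h7⟩ := h4 g hg hgq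
  have hl0 := hl.1
  have hlδ : L * l ≤ δ := by
    rw [mul_comm]; exact (le_div_iff₀ hL0).1 (hl.2.trans (min_le_right _ _))
  refine (h1 (χ q) (mem_image_of_mem _ hq) (L * l) ⟨by positivity, hlδ⟩ (χ p) (h3 p hp).2 _
    (hχ.isTest_transport h5).contDiff h6 _ (h7 B hB)).trans (le_of_eq ?_)
  rw [Real.mul_rpow hL0.le hl0.le]
  ring

/-- Being a reconstruction is invariant under diffeomorphisms. -/
lemma stronglyReconstructs_comp (hχ : IsDiffeo χ) (hR : StronglyReconstructs γ χ.target G R) :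
    StronglyReconstructs γ χ.source (fun x h => G (χ x) (transport χ h))
      fun h => R (transport χ h) := by
  intro K hK hKs
  obtain ⟨r, C, δ, hC, hδ, h1⟩ := hR (χ '' K)
    (hK.image_of_continuousOn (χ.continuousOn.mono hKs)) (by
      rintro _ ⟨x, hx, rfl⟩
      exact χ.map_source (hKs hx))
  obtain ⟨A, L, δ', hA, hL, hδ', h2⟩ := hχ.exists_transport_scale (𝕜 := 𝕜) hK hKs r
  have hL0 : 0 < L := one_pos.trans_le hL
  refine ⟨r, C * A * L ^ (γ + d), min δ' (δ / L), by positivity,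
    lt_min hδ' (by positivity), fun q hq l hl g hg hgq B hB => ?_⟩
  obtain ⟨h5, h6, h7⟩ := (h2 q hq l ⟨hl.1, hl.2.trans (min_le_left _ _)⟩).2 g hg hgq
  have hl0 := hl.1
  have hlδ : L * l ≤ δ := by
    rw [mul_comm]; exact (le_div_iff₀ hL0).1 (hl.2.trans (min_le_right _ _))
  refine (h1 (χ q) (mem_image_of_mem _ hq) (L * l) ⟨by positivity, hlδ⟩ _
    (hχ.isTest_transport h5).contDiff h6 _ (h7 B hB)).trans (le_of_eq ?_)
  rw [Real.mul_rpow hL0.le hl0.le]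
  ring

end IsDiffeo

end Transport

end GermReconstruction

end

noncomputable section

namespace GermReconstruction

open Set Filter Topology MeasureTheory Metric

section Rescale

variable {𝕜 : Type*} [RCLike 𝕜] {d : ℕ}

/-- The uniform estimates imply those for the rescalings of a fixed test function `φ`; the latter
is supported in `closedBall 0 ρ`, so its rescaling by `s` lives at the scale `s ρ`. -/
lemma StronglyReconstructs.exists_norm_apply_rescale_le {γ : ℝ} {W : Set (E d)}
    {G : E d → (E d → 𝕜) → 𝕜} {R : (E d → 𝕜) → 𝕜} (hR : StronglyReconstructs γ W G R)
    {K : Set (E d)} (hK : IsCompact K) (hKW : K ⊆ W) {φ : E d → 𝕜} (hφ : ContDiff ℝ ∞ φ)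
    (hφ' : HasCompactSupport φ) : ∃ C : ℝ, ∃ η ∈ Ioc (0 : ℝ) 1, ∀ y ∈ K, ∀ s ∈ Ioc 0 η,
      ‖R (rescale φ y s) - G y (rescale φ y s)‖ ≤ C * s ^ γ := by
  obtain ⟨r, C, δ, hC, hδ, h1⟩ := hR K hK hKW
  obtain ⟨ρ, hρ1, hρ⟩ := exists_pos_norm_le_of_hasCompactSupport hφ'
  obtain ⟨B, hB⟩ := exists_derivBound hφ hφ' r one_pos
  have hρ0 : 0 < ρ := one_pos.trans_le hρ1
  refine ⟨C * (ρ ^ r * B) * ρ ^ (γ + d), min (δ / ρ) 1, ⟨lt_min (by positivity) one_pos,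
    min_le_right _ _⟩, fun y hy s hs => ?_⟩
  have hs0 := hs.1
  have hsδ : s * ρ ≤ δ := (le_div_iff₀ hρ0).1 (hs.2.trans (min_le_left _ _))
  have h2 : DerivBound r s ((s ^ d)⁻¹ * B) (rescale φ y s) := by
    intro i hi x
    have h3 := hB.comp_smul_sub hφ hs0 one_pos y i hi x
    rw [mul_one] at h3
    have h4 : ContDiff ℝ ∞ fun x => φ (s⁻¹ • (x - y)) := by fun_prop
    have h5 : iteratedFDeriv ℝ i (rescale φ y s) x =
        (s ^ d)⁻¹ • iteratedFDeriv ℝ i (fun x => φ (s⁻¹ • (x - y))) x :=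
      iteratedFDeriv_const_smul_apply (a := (s ^ d)⁻¹) (f := fun x => φ (s⁻¹ • (x - y)))
        (h4.of_le (mod_cast le_top)).contDiffAt
    rw [h5, norm_smul, Real.norm_of_nonneg (by positivity), mul_assoc]
    gcongr
  have h3 := h2.mul_scale hs0 hρ1
  rw [mul_comm ρ s] at h3
  refine (h1 y hy (s * ρ) ⟨by positivity, hsδ⟩ _ (contDiff_rescale hφ y s)
    (tsupport_rescale_subset hρ y hs0) _ h3).trans (le_of_eq ?_)
  rw [Real.mul_rpow hs0.le hρ0.le, Real.rpow_add hs0, Real.rpow_natCast]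
  field_simp

lemma exists_isTest_integral_ne_zero {W : Set (E d)} (hW : IsOpen W) {x : E d} (hx : x ∈ W) :
    ∃ f : E d → 𝕜, IsTest W f ∧ ∫ y, f y ≠ 0 := by
  obtain ⟨ρ, hρ, hρW⟩ := Metric.nhds_basis_closedBall.mem_iff.1 (hW.mem_nhds hx)
  let b : ContDiffBump x := ⟨ρ / 2, ρ, by positivity, by linarith⟩
  refine ⟨fun y => (b y : 𝕜), .of_subset_compact ?_ (isCompact_closedBall x ρ) ?_ hρW, ?_⟩
  · exact (RCLike.ofRealCLM (K := 𝕜)).contDiff.comp b.contDiff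
  · refine (closure_mono fun y hy => ?_).trans b.tsupport_eq.subset
    intro h0
    exact hy (by simp only [h0, RCLike.ofReal_zero])
  · rw [integral_ofReal]
    exact_mod_cast b.integral_pos.ne'

end Rescale

/-! ### Germs in charts -/

section Charts

variable {𝕜 : Type*} [RCLike 𝕜] {d : ℕ} {M : Type*} [TopologicalSpace M] [ChartedSpace (E d) M]

/-- The transition map from the chart `e'` to the chart `e`. -/
def transition (e' e : Chart d M) : OpenPartialHomeomorph (E d) (E d) := e'.1.symm.trans e.1

lemma isDiffeo_transition (e' e : Chart d M) : IsDiffeo (transition e' e) := by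
  have h := (contDiffGroupoid ∞ (𝓡 d)).compatible_of_mem_maximalAtlas e'.2 e.2
  have h1 := (mem_groupoid_of_pregroupoid.1 h)
  simp only [contDiffPregroupoid, modelWithCornersSelf_coe, modelWithCornersSelf_coe_symm,
    Function.comp_id, Function.id_comp, preimage_id, range_id, inter_univ] at h1
  exact ⟨h1.1, h1.2⟩

lemma transition_apply (e' e : Chart d M) (x : E d) : transition e' e x = e.1 (e'.1.symm x) := rfl

lemma transition_source_subset (e' e : Chart d M) : (transition e' e).source ⊆ e'.1.target := by
  intro x hx
  simp only [transition, mfld_simps] at hx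
  exact hx.1

lemma transition_target_subset (e' e : Chart d M) : (transition e' e).target ⊆ e.1.target := by
  intro x hx
  simp only [transition, mfld_simps] at hx
  exact hx.1

lemma mem_transition_source {e' e : Chart d M} {x : E d} :
    x ∈ (transition e' e).source ↔ x ∈ e'.1.target ∧ e'.1.symm x ∈ e.1.source := by
  simp [transition]

/-- The compatibility of the components of a distribution on `M`, for unbundled test functions. -/
lemma MDistr.ext_push_eq (t : MDistr 𝕜 d M) (e' e : Chart d M) {h : E d → 𝕜}
    (hh : IsTest (transition e' e).source h) :
    Distr.ext (t.push e') h = Distr.ext (t.push e) (transport (transition e' e) h) := by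
  have h1 : IsTest (e'.image : Set (E d)) h := hh.mono (transition_source_subset e' e)
  have h2 : IsTest (e.image : Set (E d)) (transport (transition e' e) h) :=
    ((isDiffeo_transition e' e).isTest_transport hh).mono (transition_target_subset e' e)
  rw [Distr.ext_of_isTest _ h1, Distr.ext_of_isTest _ h2]
  exact t.overlap e e' _ _ hh.subset fun _ => rfl

/-- The representative in the chart `e` of a germ of distributions. Its values outside `φ(U)` are
irrelevant. -/
def localGerm (F : M → MDistr 𝕜 d M) (e : Chart d M) (x : E d) : (E d → 𝕜) → 𝕜 :=
  Distr.ext ((F (e.1.symm x)).push e)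

lemma isDistrOn_localGerm (F : M → MDistr 𝕜 d M) (e : Chart d M) (x : E d) :
    IsDistrOn (localGerm F e x) e.1.target :=
  Distr.isDistrOn_ext ((F (e.1.symm x)).push e)

lemma localGerm_eq (F : M → MDistr 𝕜 d M) (e' e : Chart d M) {x : E d}
    (hx : x ∈ (transition e' e).source) {h : E d → 𝕜} (hh : IsTest (transition e' e).source h) :
    localGerm F e' x h =
      localGerm F e (transition e' e x) (transport (transition e' e) h) := by
  rw [localGerm, MDistr.ext_push_eq _ e' e hh, localGerm, transition_apply,
    e.1.left_inv (mem_transition_source.1 hx).2]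

variable {γ : ℝ} {A : Set (Chart d M)} {F : M → MDistr 𝕜 d M}

/-- Coherence with respect to one test function implies strong coherence. For `dist p q ≤ l`, the
difference `F p - F q = (F p - F y) - (F q - F y)` is bounded by `l^(γ - α) s^α` on the rescalings
of the test function by `s ≤ l`, centred at points `y` near `q`. -/
lemma IsCoherent.stronglyCoherent (hF : IsCoherent γ A F) {e : Chart d M} (he : e ∈ A) :
    StronglyCoherent γ e.1.target (localGerm F e) := by
  intro K hK hKW
  rcases K.eq_empty_or_nonempty with rfl | ⟨x₀, hx₀⟩
  · exact ⟨0, 0, 1, le_rfl, one_pos, by simp⟩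
  obtain ⟨f, hfint, hf⟩ := hF e he ⟨_, e.1.map_target (hKW hx₀)⟩
  obtain ⟨ρ, hρ, hρW⟩ := hK.exists_cthickening_subset_open e.1.open_target hKW
  obtain ⟨α, hα, C, η, hη, hC⟩ := hf (e.1.symm '' cthickening ρ K)
    (hK.cthickening.image_of_continuousOn (e.1.continuousOn_symm.mono hρW)) (by
      rintro _ ⟨x, hx, rfl⟩
      exact e.1.map_target (hρW hx))
  obtain ⟨r, C₁, ε, hC₁, hε, hε1, h1⟩ :=
    exists_bound_of_rescale_bound f.contDiff f.hasCompactSupport hfint α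
  obtain ⟨R, hR1, hR⟩ := exists_pos_norm_le_of_hasCompactSupport f.hasCompactSupport
  have hαγ : 0 ≤ γ - α := by linarith [hα.trans (min_le_right _ _)]
  refine ⟨r, C₁ * (2 * |C| * 4 ^ (γ - α)), min η (ρ / (2 + R)), by positivity,
    lt_min hη.1 (by positivity), fun q hq l hl p hp g hg hgq B hB => ?_⟩
  have hl0 := hl.1
  have hlη : l ≤ η := hl.2.trans (min_le_left _ _)
  have hlρ : l * (2 + R) ≤ ρ := (le_div_iff₀ (by positivity)).1 (hl.2.trans (min_le_right _ _))
  have hth : ∀ y, dist y q ≤ l * (2 + R) → y ∈ cthickening ρ K := fun y hy =>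
    mem_cthickening_of_dist_le _ q _ _ hq (hy.trans hlρ)
  have hlR : 0 < l * R := by positivity
  have hball : closedBall q (3 * l) ⊆ e.1.target := fun y hy => hρW (hth y (by
    have : dist y q ≤ 3 * l := hy
    nlinarith))
  have hpK : p ∈ cthickening ρ K := hth p (by nlinarith)
  have hqK : q ∈ cthickening ρ K := hth q (by rw [dist_self]; positivity)
  have hbound : ∀ y ∈ closedBall q (2 * l), ∀ s ∈ Ioc 0 (ε * l),
      ‖localGerm F e p (rescale f y s) - localGerm F e q (rescale f y s)‖ ≤
        2 * |C| * (4 * l) ^ (γ - α) * s ^ α := by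
    intro y hy s hs
    have hy : dist y q ≤ 2 * l := hy
    have hs0 := hs.1
    have hsl : s ≤ l := hs.2.trans (mul_le_of_le_one_left hl0.le hε1)
    have hyK : y ∈ cthickening ρ K := hth y (by nlinarith)
    have ht : IsTest e.1.target (rescale f y s) := by
      refine isTest_rescale f.contDiff hR hs0 fun z hz => hρW (hth z ?_)
      have hz : dist z y ≤ s * R := hz
      have hsR : s * R ≤ l * R := by gcongr
      linarith [dist_triangle z y q]
    have hstep : ∀ z ∈ cthickening ρ K, dist z y ≤ 3 * l →
        ‖localGerm F e z (rescale f y s) - localGerm F e y (rescale f y s)‖ ≤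
          |C| * (s ^ α * (4 * l) ^ (γ - α)) := by
      intro z hz hzy
      have ht' : IsTest (e.image : Set (E d)) (rescale f y s) := ht
      have h2 := hC _ (mem_image_of_mem _ hz) _ (mem_image_of_mem _ hyK) s ⟨hs0, hsl.trans hlη⟩
        ht'.toTestFunction fun x => by rw [e.1.right_inv (hρW hyK)]; rfl
      rw [e.1.right_inv (hρW hyK), e.1.right_inv (hρW hz)] at h2
      rw [localGerm, localGerm, Distr.ext_of_isTest _ ht', Distr.ext_of_isTest _ ht']
      refine h2.trans ?_
      have h3 : ‖z - y‖ + s ≤ 4 * l := by rw [← dist_eq_norm]; linarith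
      have h4 : 0 ≤ s ^ α := Real.rpow_nonneg hs0.le _
      have h5 : (‖z - y‖ + s) ^ (γ - α) ≤ (4 * l) ^ (γ - α) :=
        Real.rpow_le_rpow (by positivity) h3 hαγ
      have h6 : 0 ≤ (‖z - y‖ + s) ^ (γ - α) := Real.rpow_nonneg (by positivity) _
      calc _ ≤ |C| * (s ^ α * (‖z - y‖ + s) ^ (γ - α)) := by gcongr; exact le_abs_self C
        _ ≤ _ := by gcongr
    have h2 := hstep p hpK (by linarith [dist_triangle p q y, dist_comm q y])
    have h3 := hstep q hqK (by rw [dist_comm]; linarith)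
    calc _ = ‖(localGerm F e p (rescale f y s) - localGerm F e y (rescale f y s)) -
          (localGerm F e q (rescale f y s) - localGerm F e y (rescale f y s))‖ := by
          congr 1; ring
      _ ≤ _ := (norm_sub_le _ _).trans (add_le_add h2 h3)
      _ = _ := by ring
  refine (h1 e.1.target _ ((isDistrOn_localGerm F e p).sub (isDistrOn_localGerm F e q)) q l
    (2 * |C| * (4 * l) ^ (γ - α)) hl0 hball (by positivity) hbound g hg hgq B hB).trans
    (le_of_eq ?_)
  rw [Real.mul_rpow (by norm_num) hl0.le, show γ + (d : ℝ) = (γ - α) + (α + d) by ring,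
    Real.rpow_add hl0 (γ - α)]
  ring

/-- Strong coherence is local and invariant under changes of charts, so it passes from the charts of
an atlas to all charts. -/
lemma stronglyCoherent_of_isAtlas (hA : IsAtlas A)
    (h : ∀ e ∈ A, StronglyCoherent γ e.1.target (localGerm F e)) (e' : Chart d M) :
    StronglyCoherent γ e'.1.target (localGerm F e') := by
  intro K hK hKW
  refine hK.induction_on (p := fun S => ∃ r : ℕ, ∃ C : ℝ, ∃ δ : ℝ, 0 ≤ C ∧ 0 < δ ∧
    ∀ q ∈ S, ∀ l ∈ Ioc 0 δ, ∀ p, dist p q ≤ l → ∀ g, ContDiff ℝ ∞ g →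
      tsupport g ⊆ closedBall q l → ∀ B, DerivBound r l B g →
        ‖localGerm F e' p g - localGerm F e' q g‖ ≤ C * B * l ^ (γ + d))
    ⟨0, 0, 1, le_rfl, one_pos, by simp⟩ ?_ ?_ ?_
  · rintro S S' hS ⟨r, C, δ, hC, hδ, h1⟩
    exact ⟨r, C, δ, hC, hδ, fun q hq => h1 q (hS hq)⟩
  · rintro S S' ⟨r, C, δ, hC, hδ, h1⟩ ⟨r', C', δ', hC', hδ', h1'⟩
    refine ⟨max r r', max C C', min δ δ', hC.trans (le_max_left _ _), lt_min hδ hδ', ?_⟩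
    rintro q hq l ⟨hl0, hl⟩ p hp g hg hgq B hB
    have hB0 := hB.nonneg
    rcases hq with hq | hq
    · exact (h1 q hq l ⟨hl0, hl.trans (min_le_left _ _)⟩ p hp g hg hgq B
        (hB.order_mono (le_max_left _ _))).trans (by gcongr; exact le_max_left _ _)
    · exact (h1' q hq l ⟨hl0, hl.trans (min_le_right _ _)⟩ p hp g hg hgq B
        (hB.order_mono (le_max_right _ _))).trans (by gcongr; exact le_max_right _ _)
  · intro x hx
    obtain ⟨e, he, hxe⟩ := hA (e'.1.symm x)
    set χ := transition e' e with hχ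
    have hχd : IsDiffeo χ := isDiffeo_transition e' e
    have hxχ : x ∈ χ.source := mem_transition_source.2 ⟨hKW hx, hxe⟩
    obtain ⟨ρ, hρ, hρW⟩ := Metric.nhds_basis_closedBall.mem_iff.1 (χ.open_source.mem_nhds hxχ)
    have h1 : StronglyCoherent γ χ.target (localGerm F e) := fun K hK hKt =>
      h e he K hK (hKt.trans (transition_target_subset e' e))
    obtain ⟨r, C, δ, hC, hδ, h2⟩ := hχd.stronglyCoherent_comp h1 (closedBall x (ρ / 2))
      (isCompact_closedBall _ _) ((closedBall_subset_closedBall (by linarith)).trans hρW)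
    refine ⟨closedBall x (ρ / 2), mem_nhdsWithin_of_mem_nhds (closedBall_mem_nhds x (by positivity)),
      r, C, min δ (ρ / 2), hC, lt_min hδ (by positivity), fun q hq l hl p hp g hg hgq B hB => ?_⟩
    have hq' : dist q x ≤ ρ / 2 := hq
    have hlρ : l ≤ ρ / 2 := hl.2.trans (min_le_right _ _)
    have hsub : closedBall q l ⊆ χ.source :=
      (closedBall_subset_closedBall' (by linarith)).trans hρW
    have hgt : IsTest χ.source g := .of_subset_compact hg (isCompact_closedBall q l) hgq hsub
    rw [localGerm_eq F e' e (hsub hp) hgt,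
      localGerm_eq F e' e (hsub (mem_closedBall_self hl.1.le)) hgt]
    exact h2 q hq l ⟨hl.1, hl.2.trans (min_le_left _ _)⟩ p hp g hg hgq B hB

/-- A distribution on `M` whose components satisfy the uniform estimates is a reconstruction with
respect to every set of charts. -/
lemma isReconstruction_of_stronglyReconstructs {R : MDistr 𝕜 d M} (A : Set (Chart d M))
    (hR : ∀ e : Chart d M,
      StronglyReconstructs γ e.1.target (localGerm F e) (Distr.ext (R.push e))) :
    IsReconstruction γ A F R := by
  intro e _ K hK hKs h
  obtain ⟨C, η, hη, h1⟩ := (hR e).exists_norm_apply_rescale_le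
    (hK.image_of_continuousOn (e.1.continuousOn.mono hKs)) (by
      rintro _ ⟨p, hp, rfl⟩
      exact e.1.map_source (hKs hp)) h.contDiff h.hasCompactSupport
  refine ⟨C, η, hη, fun p hp s hs g hg => ?_⟩
  have h2 := h1 (e.1 p) (mem_image_of_mem _ hp) s hs
  rwa [localGerm, e.1.left_inv (hKs hp), Distr.ext_eq _ g hg, Distr.ext_eq _ g hg] at h2

/-- The components of the reconstruction in two charts are compatible: their difference on the
overlap is small on the rescalings of a bump function, hence zero. -/
lemma eq_transport_of_stronglyReconstructs (hγ : 0 < γ) {e' e : Chart d M}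
    {R' R : (E d → 𝕜) → 𝕜} (hR' : IsDistrOn R' e'.1.target) (hR : IsDistrOn R e.1.target)
    (hF' : StronglyReconstructs γ e'.1.target (localGerm F e') R')
    (hF : StronglyReconstructs γ e.1.target (localGerm F e) R) {h : E d → 𝕜}
    (hh : IsTest (transition e' e).source h) :
    R' h = R (transport (transition e' e) h) := by
  set χ := transition e' e with hχ
  have hχd : IsDiffeo χ := isDiffeo_transition e' e
  obtain ⟨f, hf, hfint⟩ := exists_isTest_integral_ne_zero (𝕜 := 𝕜) isOpen_univ (mem_univ (0 : E d))
  obtain ⟨ρ₁, M₁, hk⟩ := exists_isKernel hf.contDiff hf.compact hfint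
  have hF₁ : StronglyReconstructs γ χ.target (localGerm F e) R := fun K hK hKt =>
    hF K hK (hKt.trans (transition_target_subset e' e))
  have hT := (hR'.mono (transition_source_subset e' e)).sub (hχd.isDistrOn_comp_transport
    (hR.mono (transition_target_subset e' e)))
  refine sub_eq_zero.1 (hk.apply_eq_zero χ.open_source hT hγ (fun x hx => ?_) hh)
  obtain ⟨ρ, hρ, hρW⟩ := Metric.nhds_basis_closedBall.mem_iff.1 (χ.open_source.mem_nhds hx)
  have hsub : closedBall x (ρ / 2) ⊆ χ.source :=
    (closedBall_subset_closedBall (by linarith)).trans hρW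
  obtain ⟨C', η', hη', h1⟩ := hF'.exists_norm_apply_rescale_le (isCompact_closedBall x (ρ / 2))
    (hsub.trans (transition_source_subset e' e)) hk.contDiff hk.compact
  obtain ⟨C, η, hη, h2⟩ := (hχd.stronglyReconstructs_comp hF₁).exists_norm_apply_rescale_le
    (isCompact_closedBall x (ρ / 2)) hsub hk.contDiff hk.compact
  have hρ₁ := hk.pos
  refine ⟨C' + C, min (min η η') (min (ρ / 2) (ρ / 2 / ρ₁)), lt_min (lt_min hη.1 hη'.1)
    (lt_min (by positivity) (by positivity)), fun y hy s hs => ?_⟩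
  have hyx : y ∈ closedBall x (ρ / 2) :=
    mem_closedBall.2 (le_of_lt hy |>.trans ((min_le_right _ _).trans (min_le_left _ _)))
  have hs0 := hs.1
  have hsη : s ≤ η := hs.2.trans ((min_le_left _ _).trans (min_le_left _ _))
  have hsη' : s ≤ η' := hs.2.trans ((min_le_left _ _).trans (min_le_right _ _))
  have hsρ : s * ρ₁ ≤ ρ / 2 :=
    (le_div_iff₀ hρ₁).1 (hs.2.trans ((min_le_right _ _).trans (min_le_right _ _)))
  have hyx' : dist y x ≤ ρ / 2 := hyx
  have ht := isTest_rescale hk.contDiff hk.norm_le hs0 (W := χ.source) (y := y)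
    ((closedBall_subset_closedBall' (by linarith)).trans hρW)
  have h3 := h1 y hyx s ⟨hs0, hsη'⟩
  have h4 := h2 y hyx s ⟨hs0, hsη⟩
  rw [localGerm_eq F e' e (hsub hyx) ht, ← hχ] at h3
  rw [add_mul, ← sub_sub_sub_cancel_right _ _
    (localGerm F e (χ y) (transport χ (rescale ((∫ x, f x)⁻¹ • f) y s)))]
  exact (norm_sub_le _ _).trans (add_le_add h3 h4)

/-- A strongly coherent germ has a reconstruction with respect to every set of charts. -/
lemma exists_isReconstruction (hγ : 0 < γ)
    (h : ∀ e : Chart d M, StronglyCoherent γ e.1.target (localGerm F e)) :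
    ∃ R : MDistr 𝕜 d M, ∀ A : Set (Chart d M), IsReconstruction γ A F R := by
  have h1 := fun e : Chart d M => (h e).exists_stronglyReconstructs hγ e.1.open_target
    (isDistrOn_localGerm F e)
  choose R hR hRF using h1
  have hR' : ∀ e : Chart d M, IsDistrOn (R e) (e.image : Set (E d)) := hR
  let R₀ : MDistr 𝕜 d M :=
    { push := fun e => (hR' e).toDistr
      overlap := fun e e' f g hf hg => by
        rw [IsDistrOn.toDistr_apply, IsDistrOn.toDistr_apply, funext hg]
        exact eq_transport_of_stronglyReconstructs hγ (hR e') (hR e) (hRF e') (hRF e)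
          ⟨f.contDiff, f.hasCompactSupport, hf⟩ }
  refine ⟨R₀, fun A => isReconstruction_of_stronglyReconstructs A fun e K hK hKW => ?_⟩
  obtain ⟨δ₀, hδ₀, hδW⟩ := hK.exists_cthickening_subset_open e.1.open_target hKW
  obtain ⟨r, C, δ, hC, hδ, h2⟩ := hRF e K hK hKW
  refine ⟨r, C, min δ δ₀, hC, lt_min hδ hδ₀, fun q hq l hl g hg hgq B hB => ?_⟩
  have hg' : IsTest (e.image : Set (E d)) g :=
    .of_subset_compact hg (isCompact_closedBall q l) hgq ((closedBall_subset_closedBall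
      (hl.2.trans (min_le_right _ _))).trans ((closedBall_subset_cthickening hq δ₀).trans hδW))
  rw [show Distr.ext (R₀.push e) g = R e g from (hR' e).ext_toDistr hg']
  exact h2 q hq l ⟨hl.1, hl.2.trans (min_le_left _ _)⟩ g hg hgq B hB

/-- Two reconstructions of `F` with respect to `A` have the same component in each chart of `A`. -/
lemma IsReconstruction.ext_push_eq (hγ : 0 < γ) {R R' : MDistr 𝕜 d M}
    (hR : IsReconstruction γ A F R) (hR' : IsReconstruction γ A F R') {e : Chart d M}
    (he : e ∈ A) {h : E d → 𝕜} (hh : IsTest e.1.target h) :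
    Distr.ext (R.push e) h = Distr.ext (R'.push e) h := by
  rcases e.1.target.eq_empty_or_nonempty with h0 | ⟨x₀, hx₀⟩
  · have : h = 0 := by
      have := hh.subset
      rwa [h0, subset_empty_iff, tsupport_eq_empty_iff] at this
    rw [this, (Distr.isDistrOn_ext _).map_zero, (Distr.isDistrOn_ext _).map_zero]
  obtain ⟨f, hf, hfint⟩ := exists_isTest_integral_ne_zero (𝕜 := 𝕜) e.1.open_target hx₀
  obtain ⟨ρ₁, M₁, hk⟩ := exists_isKernel hf.contDiff hf.compact hfint
  have hft : IsTest (e.image : Set (E d)) ((∫ x, f x)⁻¹ • f) := hf.const_smul _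
  have hT : IsDistrOn (fun h => Distr.ext (R.push e) h - Distr.ext (R'.push e) h) e.1.target :=
    (Distr.isDistrOn_ext (R.push e)).sub (Distr.isDistrOn_ext (R'.push e))
  refine sub_eq_zero.1 (hk.apply_eq_zero e.1.open_target hT hγ (fun x hx => ?_) hh)
  obtain ⟨ρ, hρ, hρW⟩ := Metric.nhds_basis_closedBall.mem_iff.1 (e.1.open_target.mem_nhds hx)
  have hK : IsCompact (e.1.symm '' closedBall x (ρ / 2)) :=
    (isCompact_closedBall _ _).image_of_continuousOn (e.1.continuousOn_symm.mono
      ((closedBall_subset_closedBall (by linarith)).trans hρW))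
  have hKs : e.1.symm '' closedBall x (ρ / 2) ⊆ e.1.source := by
    rintro _ ⟨y, hy, rfl⟩
    exact e.1.map_target (hρW (closedBall_subset_closedBall (by linarith) hy))
  obtain ⟨C, η, hη, h1⟩ := hR e he _ hK hKs hft.toTestFunction
  obtain ⟨C', η', hη', h1'⟩ := hR' e he _ hK hKs hft.toTestFunction
  have hρ₁ := hk.pos
  refine ⟨C + C', min (min η η') (min (ρ / 2) (ρ / 2 / ρ₁)), lt_min (lt_min hη.1 hη'.1)
    (lt_min (by positivity) (by positivity)), fun y hy s hs => ?_⟩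
  have hyx : y ∈ closedBall x (ρ / 2) :=
    mem_closedBall.2 (le_of_lt hy |>.trans ((min_le_right _ _).trans (min_le_left _ _)))
  have hs0 := hs.1
  have hsη : s ≤ η := hs.2.trans ((min_le_left _ _).trans (min_le_left _ _))
  have hsη' : s ≤ η' := hs.2.trans ((min_le_left _ _).trans (min_le_right _ _))
  have hsρ : s * ρ₁ ≤ ρ / 2 :=
    (le_div_iff₀ hρ₁).1 (hs.2.trans ((min_le_right _ _).trans (min_le_right _ _)))
  have hyx' : dist y x ≤ ρ / 2 := hyx
  have ht : IsTest (e.image : Set (E d)) (rescale ((∫ x, f x)⁻¹ • f) y s) :=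
    isTest_rescale hk.contDiff hk.norm_le hs0
      ((closedBall_subset_closedBall' (by linarith)).trans hρW)
  have hey : e.1 (e.1.symm y) = y :=
    e.1.right_inv (hρW (closedBall_subset_closedBall (by linarith) hyx))
  have h3 := h1 _ (mem_image_of_mem _ hyx) s ⟨hs0, hsη⟩ ht.toTestFunction
    fun z => by rw [hey]; rfl
  have h4 := h1' _ (mem_image_of_mem _ hyx) s ⟨hs0, hsη'⟩ ht.toTestFunction
    fun z => by rw [hey]; rfl
  simp only [Distr.ext_of_isTest _ ht]
  rw [add_mul, ← sub_sub_sub_cancel_right _ _ ((F (e.1.symm y)).push e ht.toTestFunction)]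
  exact (norm_sub_le _ _).trans (add_le_add h3 h4)

/-- Reconstructions are unique. The difference of the components in an arbitrary chart vanishes
near each point, by comparison with a chart of the atlas. -/
lemma IsReconstruction.eq (hγ : 0 < γ) (hA : IsAtlas A) {R R' : MDistr 𝕜 d M}
    (hR : IsReconstruction γ A F R) (hR' : IsReconstruction γ A F R') : R = R' := by
  ext e' h
  rw [← Distr.ext_coe, ← Distr.ext_coe]
  obtain ⟨f, hf, hfint⟩ := exists_isTest_integral_ne_zero (𝕜 := 𝕜) isOpen_univ (mem_univ (0 : E d))
  obtain ⟨ρ₁, M₁, hk⟩ := exists_isKernel hf.contDiff hf.compact hfint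
  have hT : IsDistrOn (fun h => Distr.ext (R.push e') h - Distr.ext (R'.push e') h) e'.1.target :=
    (Distr.isDistrOn_ext (R.push e')).sub (Distr.isDistrOn_ext (R'.push e'))
  refine sub_eq_zero.1 (hk.apply_eq_zero e'.1.open_target hT hγ (fun x hx => ?_) (isTest_coe h))
  obtain ⟨e, he, hxe⟩ := hA (e'.1.symm x)
  obtain ⟨ρ, hρ, hρW⟩ := Metric.nhds_basis_closedBall.mem_iff.1
    ((transition e' e).open_source.mem_nhds (mem_transition_source.2 ⟨hx, hxe⟩))
  have hρ₁ := hk.pos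
  refine ⟨0, min (ρ / 2) (ρ / 2 / ρ₁), lt_min (by positivity) (by positivity), fun y hy s hs => ?_⟩
  have hyx : dist y x ≤ ρ / 2 := (le_of_lt hy).trans (min_le_left _ _)
  have hsρ : s * ρ₁ ≤ ρ / 2 := (le_div_iff₀ hρ₁).1 (hs.2.trans (min_le_right _ _))
  have ht := isTest_rescale hk.contDiff hk.norm_le hs.1 (W := (transition e' e).source) (y := y)
    ((closedBall_subset_closedBall' (by linarith)).trans hρW)
  rw [MDistr.ext_push_eq R e' e ht, MDistr.ext_push_eq R' e' e ht,
    hR.ext_push_eq hγ hR' he (((isDiffeo_transition e' e).isTest_transport ht).mono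
      (transition_target_subset e' e)), sub_self, norm_zero, zero_mul]

end Charts

end GermReconstruction

end

theorem theorem3p2 {𝕜 : Type*} [RCLike 𝕜] {d : ℕ} {M : Type*} [TopologicalSpace M]
    [T2Space M] [SecondCountableTopology M] [MeasurableSpace M] [BorelSpace M]
    [ChartedSpace (EuclideanSpace ℝ (Fin d)) M] [IsManifold (𝓡 d) ∞ M]
    (A A' : Set (GermReconstruction.Chart d M))
    (hA : GermReconstruction.IsAtlas A) (hA' : GermReconstruction.IsAtlas A')
    (γ : ℝ) (hγ : 0 < γ) (F : M → GermReconstruction.MDistr 𝕜 d M)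
    (hF : GermReconstruction.IsGerm F) (hcoh : GermReconstruction.IsCoherent γ A F) :
    (∃! R : GermReconstruction.MDistr 𝕜 d M, GermReconstruction.IsReconstruction γ A F R) ∧
    (∃! R' : GermReconstruction.MDistr 𝕜 d M, GermReconstruction.IsReconstruction γ A' F R') ∧
    ∀ R R' : GermReconstruction.MDistr 𝕜 d M, GermReconstruction.IsReconstruction γ A F R →
      GermReconstruction.IsReconstruction γ A' F R' → R = R' := by
  obtain ⟨R₀, hR₀⟩ := GermReconstruction.exists_isReconstruction hγ
    (GermReconstruction.stronglyCoherent_of_isAtlas hA fun e he => hcoh.stronglyCoherent he)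
  exact ⟨⟨R₀, hR₀ A, fun R hR => hR.eq hγ hA (hR₀ A)⟩,
    ⟨R₀, hR₀ A', fun R hR => hR.eq hγ hA' (hR₀ A')⟩,
    fun R R' hR hR' => (hR.eq hγ hA (hR₀ A)).trans ((hR₀ A').eq hγ hA' hR')⟩
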